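/- Let $Y\in[0,1]$ be a buyer's valuation and $X\in[0,1]$ a covariate. A joint distribution $F$ of $(Y,X)$ is given by a conditional density $f_{Y|X}(y|x)$ and a marginal density $f_X(x)$ on $[0,1]$; put $F_{Y|X}(y|x)=\int_0^y f_{Y|X}(t|x)\,dt$ and $r(y,x)=y\,(1-F_{Y|X}(y|x))$. For a measurable pricing function $p:[0,1]\to[0,1]$ the expected revenue is $R(p,F)=\int_0^1 r(p(x),x)f_X(x)\,dx$, and $R^*(F)=\sup_p R(p,F)$ is the expected revenue of the true optimal strategy. Fix constants $C_0>0$, $C^*\in(0,2)$, $\overline C>2$, $0<\underline C\le 1\le\overline C'$, and let $\mathcal F$ be the class of all joint distributions such that: (i) $|f_{Y|X}(y|x)-f_{Y|X}(y'|x)|\le C_0|y-y'|$ for all $y,y',x\in[0,1]$; (ii) for every $x\in[0,1]$, $y\mapsto r(y,x)$ is strictly concave on $[0,1]$ and $-2f_{Y|X}(y|x)-y\,\partial_y f_{Y|X}(y|x)\le -C^*$ for almost every $y\in[0,1]$; (iii) for every $x\in[0,1]$ the optimal price $p^*(x)=\operatorname{argmax}_{y\in[0,1]}r(y,x)$ lies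 in $(0,1)$; (iv) $f_{Y|X}$ is continuously differentiable in $(y,x)$ in a neighbourhood, relative to $[0,1]^2$, of the curve $\{(p^*(x),x):x\in[0,1]\}$; (v) $|2f_{Y|X}(y|x)+y\,\partial_y f_{Y|X}(y|x)|\le\overline C$ for every $x\in[0,1]$ and almost every $y\in[0,1]$, and for almost every $(y,x)\in[0,1]^2$ the partial derivatives $\partial_xF_{Y|X}(y|x)$ and $\partial_xf_{Y|X}(y|x)$ exist and $|\partial_xF_{Y|X}(y|x)+y\,\partial_xf_{Y|X}(y|x)|\le\overline C$; (vi) $\underline C\le f_X(x)\le\overline C'$ for all $x\in[0,1]$. Then there is a constant $c>0$, which does not depend on $n$, such that for every $n\ge1$ $$\inf_{\check p}\ \sup_{F\in\mathcal F}\Big(R^*(F)-\mathbb E_F\big[R(\check p(\mathrm{data}),F)\big]\Big)\ \ge\ c\,n^{-1/2},$$ where the data are $n$ i.i.d. draws $(Y_i,X_i)$ from $F$, and the infimum is over all data-based pricing functions $\check p$, that is, maps (jointly measurable in the data and the covariate) which assign a pricing function $\check p(\mathrm{data}):[0,1]\to[0,1]$ to every data set. -/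

import Mathlib

open MeasureTheory

noncomputable section

namespace Pricing

/-- The joint law of a valuation `Y` and a covariate `X`, both with values in `[0,1]`, given by the
conditional density `cond y x` of `Y` at `y` given `X = x`, and the marginal density `marg` of `X`.
Only the values for `x, y` in `[0,1]` matter. -/
structure JointDist where
  cond : ℝ → ℝ → ℝ
  marg : ℝ → ℝ
  measurable_cond : Measurable (fun z : ℝ × ℝ => cond z.1 z.2)
  measurable_marg : Measurable marg
  cond_nonneg : ∀ y ∈ Set.Icc (0 : ℝ) 1, ∀ x ∈ Set.Icc (0 : ℝ) 1, 0 ≤ cond y x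
  marg_nonneg : ∀ x ∈ Set.Icc (0 : ℝ) 1, 0 ≤ marg x
  cond_integral : ∀ x ∈ Set.Icc (0 : ℝ) 1, ∫ y in (0 : ℝ)..1, cond y x = 1
  marg_integral : ∫ x in (0 : ℝ)..1, marg x = 1

/-- Pricing functions: measurable maps from `[0,1]` to `[0,1]` (the values of the representative
outside `[0,1]` play no role). -/
def pricingFunctions : Set (ℝ → ℝ) :=
  {p | Measurable p ∧ ∀ x ∈ Set.Icc (0 : ℝ) 1, p x ∈ Set.Icc (0 : ℝ) 1}

/-- Data-based pricing functions for a sample of size `n`: a pricing function for every data set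
`((Y 1, X 1), ..., (Y n, X n))`, jointly measurable in the data and the covariate. -/
structure DataPricing (n : ℕ) where
  price : (Fin n → ℝ × ℝ) → ℝ → ℝ
  measurable_price : Measurable (fun z : (Fin n → ℝ × ℝ) × ℝ => price z.1 z.2)
  price_mem : ∀ d, ∀ x ∈ Set.Icc (0 : ℝ) 1, price d x ∈ Set.Icc (0 : ℝ) 1

namespace JointDist

/-- The law of `(Y, X)` as a measure on the plane, carried by the unit square. -/
def law (F : JointDist) : Measure (ℝ × ℝ) :=
  (volume.restrict (Set.Icc (0 : ℝ) 1 ×ˢ Set.Icc (0 : ℝ) 1)).withDensity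
    (fun z => ENNReal.ofReal (F.cond z.1 z.2 * F.marg z.2))

/-- The conditional distribution function of `Y` at `y ∈ [0,1]` given `X = x`. -/
def cdf (F : JointDist) (y x : ℝ) : ℝ := ∫ t in (0 : ℝ)..y, F.cond t x

/-- The revenue at price `y` and covariate value `x`. -/
def rev (F : JointDist) (y x : ℝ) : ℝ := (1 - F.cdf y x) * y

/-- The expected revenue of a pricing function. -/
def revenue (F : JointDist) (p : ℝ → ℝ) : ℝ := ∫ x in (0 : ℝ)..1, F.rev (p x) x * F.marg x

/-- The expected revenue of the true-distribution optimal pricing strategy: the supremum over all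
pricing functions (a nonempty set of numbers in `[0,1]`). -/
def optimalRevenue (F : JointDist) : ℝ := sSup (F.revenue '' pricingFunctions)

/-- `p` is an optimal price at the covariate value `x`. -/
def IsOptimalPrice (F : JointDist) (x p : ℝ) : Prop :=
  p ∈ Set.Icc (0 : ℝ) 1 ∧ IsMaxOn (fun y => F.rev y x) (Set.Icc (0 : ℝ) 1) p

/-- The revenue of a data-based pricing function, averaged over a data set of `n` independent draws
from `F`. -/
def meanRevenue (F : JointDist) {n : ℕ} (q : DataPricing n) : ℝ :=
  ∫ d, F.revenue (q.price d) ∂(Measure.pi (fun _ : Fin n => F.law))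

end JointDist

/-- The regularity conditions on a joint distribution, with given constants. -/
structure Regular (C₀ Cstar Cbar Cmarg cmarg : ℝ) (F : JointDist) : Prop where
  lipschitz : ∀ y ∈ Set.Icc (0 : ℝ) 1, ∀ y' ∈ Set.Icc (0 : ℝ) 1, ∀ x ∈ Set.Icc (0 : ℝ) 1,
    |F.cond y x - F.cond y' x| ≤ C₀ * |y - y'|
  concave : ∀ x ∈ Set.Icc (0 : ℝ) 1, StrictConcaveOn ℝ (Set.Icc (0 : ℝ) 1) (fun y => F.rev y x)
  strong : ∀ x ∈ Set.Icc (0 : ℝ) 1, ∀ᵐ y ∂(volume.restrict (Set.Icc (0 : ℝ) 1)),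
    -2 * F.cond y x - y * deriv (fun t => F.cond t x) y ≤ -Cstar
  interior : ∀ x ∈ Set.Icc (0 : ℝ) 1, ∀ p, F.IsOptimalPrice x p → p ∈ Set.Ioo (0 : ℝ) 1
  smooth : ∃ U : Set (ℝ × ℝ), IsOpen U ∧
    (∀ x ∈ Set.Icc (0 : ℝ) 1, ∀ p, F.IsOptimalPrice x p → (p, x) ∈ U) ∧
    ContDiffOn ℝ 1 (fun z : ℝ × ℝ => F.cond z.1 z.2)
      (U ∩ Set.Icc (0 : ℝ) 1 ×ˢ Set.Icc (0 : ℝ) 1)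
  bounded_y : ∀ x ∈ Set.Icc (0 : ℝ) 1, ∀ᵐ y ∂(volume.restrict (Set.Icc (0 : ℝ) 1)),
    |2 * F.cond y x + y * deriv (fun t => F.cond t x) y| ≤ Cbar
  bounded_x : ∀ᵐ z : ℝ × ℝ ∂(volume.restrict (Set.Icc (0 : ℝ) 1 ×ˢ Set.Icc (0 : ℝ) 1)),
    DifferentiableAt ℝ (fun s => F.cdf z.1 s) z.2 ∧
    DifferentiableAt ℝ (fun s => F.cond z.1 s) z.2 ∧
    |deriv (fun s => F.cdf z.1 s) z.2 + z.1 * deriv (fun s => F.cond z.1 s) z.2| ≤ Cbar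
  marg_bounds : ∀ x ∈ Set.Icc (0 : ℝ) 1, cmarg ≤ F.marg x ∧ F.marg x ≤ Cmarg

/-- The class of all joint distributions that satisfy the regularity conditions with the given
constants. -/
def distClass (C₀ Cstar Cbar Cmarg cmarg : ℝ) : Set JointDist :=
  {F | Regular C₀ Cstar Cbar Cmarg cmarg F}

/-- The minimax deficiency in expected revenue over a class of joint distributions: infimum over
the data-based pricing functions of the supremum over the class, in the extended reals. -/
def minimaxDeficiency (n : ℕ) (𝓕 : Set JointDist) : EReal :=
  ⨅ q : DataPricing n, ⨆ F ∈ 𝓕, ((F.optimalRevenue - F.meanRevenue q : ℝ) : EReal)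

end Pricing

end

/-! Start from the uniform law on the square, whose revenue `y * (1 - y)` peaks at `1/2`. Near `y =
1/2`, over a window of width of order `h`, tilt the conditional density by `ε * h * W x`, where `W`
is a row of `m = 1 / (2 * h)` disjoint bumps in the covariate with signs `ω`. A derivative in either
variable costs a factor `1 / h`, which the amplitude `ε * h` absorbs. One small `ε` therefore keeps
every vertex of the hypercube in the class for all `h` (`Admissible.regular`).

The sign of a bump moves the optimal price by about `ε * h / 4` to one side of `1/2`. The revenue is
uniformly concave, so no price suits both signs: the two losses add up to at least `ε ^ 2 * h ^ 2 /
8` (`Admissible.le_loss_add_loss`). Flipping one sign changes the density by order `ε * h` on a box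
of area of order `h ^ 2`, hence by order `h ^ 4` in squared `L²` distance
(`Admissible.integral_sq_sub_le`). If `n * h ^ 4` is at most `1 / 16`, then `n` observations cannot
identify that sign: the affinity of the product laws is at least `1 / 2` (`half_le_affinity_pow`),
and Le Cam's bound `le_two_point_loss` applies on each cell (`Admissible.le_cell_loss`).

Assouad's averaging (`exists_half_le_sum`) finds a vertex at which the cell losses sum to order `h ^
2`. Taking `h` of order `n ^ (-1 / 4)` gives the rate `n ^ (-1 / 2)`. -/

noncomputable section

namespace Pricing

/-! ### Profiles of the perturbation: cutoff and ramp -/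

/-- A smooth cutoff function on the line, equal to `1` on `[-1/2, 1/2]` and to `0` outside
`(-1, 1)`. -/
def cutoff (u : ℝ) : ℝ := (⟨1 / 2, 1, by norm_num, by norm_num⟩ : ContDiffBump (0 : ℝ)) u

theorem contDiff_cutoff {n : ℕ∞} : ContDiff ℝ n cutoff := ContDiffBump.contDiff _

theorem cutoff_nonneg (u : ℝ) : 0 ≤ cutoff u := ContDiffBump.nonneg _

theorem cutoff_le_one (u : ℝ) : cutoff u ≤ 1 := ContDiffBump.le_one _

theorem cutoff_eq_one {u : ℝ} (hu : |u| ≤ 1 / 2) : cutoff u = 1 := by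
  apply ContDiffBump.one_of_mem_closedBall
  simpa [Real.dist_eq] using hu

theorem cutoff_eq_zero {u : ℝ} (hu : 1 ≤ |u|) : cutoff u = 0 := by
  apply ContDiffBump.zero_of_le_dist
  simpa [Real.dist_eq] using hu

theorem hasCompactSupport_cutoff : HasCompactSupport cutoff := ContDiffBump.hasCompactSupport _

theorem abs_cutoff_le_one (u : ℝ) : |cutoff u| ≤ 1 := by
  rw [abs_of_nonneg (cutoff_nonneg u)]; exact cutoff_le_one u

/-- The value `0` is a global minimum of a nonnegative function. This argument also covers the
boundary `|u| = 1`, where the function need not vanish on both sides. -/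
theorem deriv_cutoff_eq_zero {u : ℝ} (hu : 1 ≤ |u|) : deriv cutoff u = 0 := by
  apply IsLocalMin.deriv_eq_zero
  refine Filter.Eventually.of_forall fun v => ?_
  rw [cutoff_eq_zero hu]
  exact cutoff_nonneg v

/-- A smooth compactly supported function on the line that is the identity on `[-1/2, 1/2]`. -/
def ramp (u : ℝ) : ℝ := u * cutoff u

theorem contDiff_ramp {n : ℕ∞} : ContDiff ℝ n ramp := contDiff_id.mul contDiff_cutoff

theorem contDiff_deriv_ramp {n : ℕ} : ContDiff ℝ n (deriv ramp) := by
  have : ContDiff ℝ ((n : WithTop ℕ∞) + 1) ramp := by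
    exact_mod_cast contDiff_ramp (n := ((n + 1 : ℕ) : ℕ∞))
  exact this.deriv'

theorem continuous_deriv_ramp : Continuous (deriv ramp) :=
  (contDiff_deriv_ramp (n := 0)).continuous

theorem hasDerivAt_ramp (u : ℝ) : HasDerivAt ramp (deriv ramp u) u :=
  ((contDiff_ramp (n := 1)).differentiable (by simp) u).hasDerivAt

theorem hasDerivAt_deriv_ramp (u : ℝ) : HasDerivAt (deriv ramp) (deriv (deriv ramp) u) u :=
  ((contDiff_deriv_ramp (n := 1)).differentiable (by simp) u).hasDerivAt

theorem ramp_eq_self {u : ℝ} (hu : |u| ≤ 1 / 2) : ramp u = u := by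
  rw [ramp, cutoff_eq_one hu, mul_one]

theorem ramp_eq_zero {u : ℝ} (hu : 1 ≤ |u|) : ramp u = 0 := by
  rw [ramp, cutoff_eq_zero hu, mul_zero]

theorem deriv_ramp_eq_zero {u : ℝ} (hu : 1 ≤ |u|) : deriv ramp u = 0 := by
  have h := (hasDerivAt_id u).mul ((contDiff_cutoff (n := 1)).differentiable (by simp) u).hasDerivAt
  have h' : deriv ramp u = 1 * cutoff u + id u * deriv cutoff u := h.deriv
  rw [h', cutoff_eq_zero hu, deriv_cutoff_eq_zero hu]
  simp

theorem hasCompactSupport_ramp : HasCompactSupport ramp := hasCompactSupport_cutoff.mul_left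

/-- A common bound for the cutoff functions and the derivatives that occur. -/
structure IsCutoffBound (B : ℝ) : Prop where
  one_le : 1 ≤ B
  ramp_le : ∀ u, |ramp u| ≤ B
  deriv_ramp_le : ∀ u, |deriv ramp u| ≤ B
  deriv2_ramp_le : ∀ u, |deriv (deriv ramp) u| ≤ B
  deriv_cutoff_le : ∀ u, |deriv cutoff u| ≤ B

theorem exists_isCutoffBound : ∃ B, IsCutoffBound B := by
  obtain ⟨B₁, h₁⟩ := (contDiff_ramp (n := 0)).continuous.bounded_above_of_compact_support
    hasCompactSupport_ramp
  obtain ⟨B₂, h₂⟩ := continuous_deriv_ramp.bounded_above_of_compact_support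
    hasCompactSupport_ramp.deriv
  obtain ⟨B₃, h₃⟩ := ((contDiff_deriv_ramp (n := 1)).continuous_deriv
    (by simp)).bounded_above_of_compact_support hasCompactSupport_ramp.deriv.deriv
  obtain ⟨B₄, h₄⟩ := ((contDiff_cutoff (n := 1)).continuous_deriv
    (by simp)).bounded_above_of_compact_support hasCompactSupport_cutoff.deriv
  simp only [Real.norm_eq_abs] at h₁ h₂ h₃ h₄
  have p₁ := (abs_nonneg _).trans (h₁ 0)
  have p₂ := (abs_nonneg _).trans (h₂ 0)
  have p₃ := (abs_nonneg _).trans (h₃ 0)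
  have p₄ := (abs_nonneg _).trans (h₄ 0)
  exact ⟨1 + B₁ + B₂ + B₃ + B₄, by linarith, fun u => by linarith [h₁ u],
    fun u => by linarith [h₂ u], fun u => by linarith [h₃ u], fun u => by linarith [h₄ u]⟩

/-! ### Waves: signed sums of disjoint bumps in the covariate -/

/-- Translates by distinct odd numbers of a function that vanishes outside `(-1, 1)` have disjoint
supports. -/
theorem eq_of_abs_sub_odd_lt_one {i j : ℕ} {u : ℝ} (hi : |u - (2 * i + 1)| < 1)
    (hj : |u - (2 * j + 1)| < 1) : i = j := by
  rw [abs_lt] at hi hj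
  have h₁ : (i : ℝ) < j + 1 := by linarith
  have h₂ : (j : ℝ) < i + 1 := by linarith
  norm_cast at h₁ h₂
  omega

theorem sum_translates_eq {m : ℕ} {g : ℝ → ℝ} (hg : ∀ u, 1 ≤ |u| → g u = 0) (w : Fin m → ℝ)
    {u : ℝ} {k : Fin m} (hk : |u - (2 * (k : ℕ) + 1)| < 1) :
    ∑ j : Fin m, w j * g (u - (2 * (j : ℕ) + 1)) = w k * g (u - (2 * (k : ℕ) + 1)) := by
  refine Finset.sum_eq_single k (fun j _ hj => ?_) (by simp)
  rw [hg, mul_zero]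
  by_contra hlt
  exact hj (Fin.ext (eq_of_abs_sub_odd_lt_one (not_le.1 hlt) hk))

/-- At most one summand is nonzero at any point, so the bound does not grow with the number of
bumps. -/
theorem abs_sum_translates_le {m : ℕ} {g : ℝ → ℝ} (hg : ∀ u, 1 ≤ |u| → g u = 0) {M : ℝ}
    (hM : ∀ u, |g u| ≤ M) {w : Fin m → ℝ} (hw : ∀ k, |w k| ≤ 1) (u : ℝ) :
    |∑ j : Fin m, w j * g (u - (2 * (j : ℕ) + 1))| ≤ M := by
  have hM0 : 0 ≤ M := (abs_nonneg _).trans (hM 0)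
  by_cases h : ∃ k : Fin m, |u - (2 * (k : ℕ) + 1)| < 1
  · obtain ⟨k, hk⟩ := h
    rw [sum_translates_eq hg w hk, abs_mul]
    calc _ ≤ 1 * M := mul_le_mul (hw k) (hM _) (abs_nonneg _) zero_le_one
      _ = M := one_mul M
  · push Not at h
    rw [Finset.sum_eq_zero fun j _ => by rw [hg _ (h j), mul_zero]]
    simpa using hM0

/-- A sum of bumps of width `2 * h` and heights `w k`, centred at the points `(2 * k + 1) * h`. -/
def wave {m : ℕ} (h : ℝ) (w : Fin m → ℝ) (x : ℝ) : ℝ :=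
  ∑ k : Fin m, w k * cutoff (x / h - (2 * (k : ℕ) + 1))

section wave
variable {m : ℕ} {h : ℝ} {w : Fin m → ℝ}

theorem contDiff_wave {n : ℕ∞} : ContDiff ℝ n (wave h w) := by
  unfold wave
  refine ContDiff.sum fun k _ => contDiff_const.mul (contDiff_cutoff.comp ?_)
  exact (contDiff_id.div_const h).sub contDiff_const

theorem abs_wave_le (hw : ∀ k, |w k| ≤ 1) (x : ℝ) : |wave h w x| ≤ 1 :=
  abs_sum_translates_le (fun _ => cutoff_eq_zero) abs_cutoff_le_one hw _

theorem deriv_wave (x : ℝ) :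
    deriv (wave h w) x = (∑ k : Fin m, w k * deriv cutoff (x / h - (2 * (k : ℕ) + 1))) / h := by
  have key : ∀ k : Fin m, HasDerivAt (fun x => w k * cutoff (x / h - (2 * (k : ℕ) + 1)))
      (w k * (deriv cutoff (x / h - (2 * (k : ℕ) + 1)) * (1 / h))) x := fun k => by
    have h₁ : HasDerivAt (fun x : ℝ => x / h - (2 * (k : ℕ) + 1)) (1 / h) x :=
      ((hasDerivAt_id x).div_const h).sub_const _
    have h₂ := ((contDiff_cutoff (n := 1)).differentiable (by simp)
      (x / h - (2 * (k : ℕ) + 1))).hasDerivAt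
    exact (h₂.comp x h₁).const_mul _
  have := (HasDerivAt.fun_sum (u := Finset.univ) fun k _ => key k).deriv
  rw [show wave h w = fun x => ∑ k : Fin m, w k * cutoff (x / h - (2 * (k : ℕ) + 1)) from rfl,
    this, Finset.sum_div]
  exact Finset.sum_congr rfl fun k _ => by ring

theorem abs_deriv_wave_le {B : ℝ} (hB : IsCutoffBound B) (hh : 0 < h) (hw : ∀ k, |w k| ≤ 1)
    (x : ℝ) : |deriv (wave h w) x| ≤ B / h := by
  rw [deriv_wave, abs_div, abs_of_pos hh]
  gcongr
  exact abs_sum_translates_le (fun _ => deriv_cutoff_eq_zero) hB.deriv_cutoff_le hw _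

theorem wave_eq_of_abs_le {x : ℝ} {k : Fin m} (hx : |x / h - (2 * (k : ℕ) + 1)| ≤ 1 / 2) :
    wave h w x = w k := by
  rw [wave, sum_translates_eq (fun _ => cutoff_eq_zero) w (hx.trans_lt (by norm_num)),
    cutoff_eq_one hx, mul_one]

/-- Neighbouring vertices of the hypercube give waves that differ by a single bump; this localizes
their statistical distance. -/
theorem wave_sub_wave {w' : Fin m → ℝ} {k : Fin m} (hww : ∀ j, j ≠ k → w j = w' j) (x : ℝ) :
    wave h w x - wave h w' x = (w k - w' k) * cutoff (x / h - (2 * (k : ℕ) + 1)) := by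
  rw [wave, wave, ← Finset.sum_sub_distrib, Finset.sum_eq_single k]
  · ring
  · intro j _ hj
    rw [hww j hj, sub_self]
  · simp

end wave

/-! ### Perturbed distributions and their membership in the class -/

/-- The conditional density obtained from the uniform one by a perturbation of height `ε * h` and
width `h` in the valuation, with amplitude `W x` at the covariate value `x`. -/
def perturbedDensity (ε h : ℝ) (W : ℝ → ℝ) (y x : ℝ) : ℝ :=
  1 + ε * h * deriv ramp ((y - 1 / 2) / h) * W x

/-- The distribution function of `perturbedDensity`. -/
def perturbedCdf (ε h : ℝ) (W : ℝ → ℝ) (y x : ℝ) : ℝ :=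
  y + ε * h ^ 2 * ramp ((y - 1 / 2) / h) * W x

/-- The revenue function of `perturbedDensity`. -/
def perturbedRev (ε h : ℝ) (W : ℝ → ℝ) (y x : ℝ) : ℝ := (1 - perturbedCdf ε h W y x) * y

/-- The maximizer of `perturbedRev`. -/
def perturbedPrice (ε h : ℝ) (W : ℝ → ℝ) (x : ℝ) : ℝ :=
  (1 + ε * h * W x / 2) / (2 * (1 + ε * h * W x))

/-- Conditions on the parameters of a perturbation of the uniform distribution. -/
structure Admissible (ε h B : ℝ) (W : ℝ → ℝ) : Prop where
  isCutoffBound : IsCutoffBound B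
  eps_pos : 0 < ε
  eps_le : ε * B ^ 2 ≤ 1 / 4
  h_pos : 0 < h
  h_le : h ≤ 1 / 2
  contDiff : ContDiff ℝ 1 W
  abs_wave_le_one : ∀ x, |W x| ≤ 1
  abs_deriv_le : ∀ x, |deriv W x| ≤ B / h

namespace Admissible

variable {ε h B : ℝ} {W : ℝ → ℝ}

theorem bound_pos (H : Admissible ε h B W) : 0 < B := zero_lt_one.trans_le H.isCutoffBound.one_le

theorem eps_mul_le (H : Admissible ε h B W) : ε * B ≤ ε * B ^ 2 := by
  have := H.isCutoffBound.one_le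
  nlinarith [mul_nonneg H.eps_pos.le (sub_nonneg.2 this)]

theorem eps_le_quarter (H : Admissible ε h B W) : ε ≤ 1 / 4 := by
  have := H.isCutoffBound.one_le
  nlinarith [mul_nonneg H.eps_pos.le (sub_nonneg.2 this), H.eps_mul_le, H.eps_le]

theorem abs_perturbation_le (H : Admissible ε h B W) (y x : ℝ) :
    |ε * h * deriv ramp ((y - 1 / 2) / h) * W x| ≤ ε * h * B := by
  have h₀ := mul_pos H.eps_pos H.h_pos
  rw [abs_mul, abs_mul, abs_of_pos h₀]
  calc _ ≤ ε * h * B * 1 := by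
        have := H.bound_pos
        gcongr
        · exact H.isCutoffBound.deriv_ramp_le _
        · exact H.abs_wave_le_one x
    _ = _ := mul_one _

theorem eps_h_B_le (H : Admissible ε h B W) : ε * h * B ≤ ε * B ^ 2 / 2 := by
  have := H.isCutoffBound.one_le
  have h₁ := H.eps_mul_le
  nlinarith [mul_nonneg (mul_nonneg H.eps_pos.le (zero_le_one.trans this)) (sub_nonneg.2 H.h_le)]

theorem density_ge (H : Admissible ε h B W) (y x : ℝ) : 1 / 2 ≤ perturbedDensity ε h W y x := by
  have h₁ := (abs_le.1 (H.abs_perturbation_le y x)).1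
  unfold perturbedDensity
  linarith [H.eps_h_B_le, H.eps_le]

theorem density_le (H : Admissible ε h B W) (y x : ℝ) : perturbedDensity ε h W y x ≤ 2 := by
  have h₁ := (abs_le.1 (H.abs_perturbation_le y x)).2
  unfold perturbedDensity
  linarith [H.eps_h_B_le, H.eps_le]

theorem contDiff_density (H : Admissible ε h B W) :
    ContDiff ℝ 1 (fun z : ℝ × ℝ => perturbedDensity ε h W z.1 z.2) := by
  unfold perturbedDensity
  refine contDiff_const.add ((contDiff_const.mul ?_).mul (H.contDiff.comp contDiff_snd))
  exact (contDiff_deriv_ramp (n := 1)).comp ((contDiff_fst.sub contDiff_const).div_const h)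

theorem continuous_density (H : Admissible ε h B W) :
    Continuous (fun z : ℝ × ℝ => perturbedDensity ε h W z.1 z.2) :=
  H.contDiff_density.continuous

theorem continuous_density_left (H : Admissible ε h B W) (x : ℝ) :
    Continuous (fun y => perturbedDensity ε h W y x) :=
  H.continuous_density.comp (by fun_prop : Continuous fun y : ℝ => (y, x))

theorem continuous_rev (H : Admissible ε h B W) :
    Continuous (fun z : ℝ × ℝ => perturbedRev ε h W z.1 z.2) := by
  have h₁ : Continuous ramp := (contDiff_ramp (n := 0)).continuous
  have h₂ : Continuous W := H.contDiff.continuous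
  unfold perturbedRev perturbedCdf
  fun_prop

theorem hasDerivAt_ramp_div (y : ℝ) :
    HasDerivAt (fun y : ℝ => ramp ((y - 1 / 2) / h)) (deriv ramp ((y - 1 / 2) / h) * (1 / h)) y :=
  (hasDerivAt_ramp _).comp y (((hasDerivAt_id y).sub_const _).div_const h)

theorem hasDerivAt_density (H : Admissible ε h B W) (y x : ℝ) :
    HasDerivAt (fun y => perturbedDensity ε h W y x)
      (ε * deriv (deriv ramp) ((y - 1 / 2) / h) * W x) y := by
  have h₁ : HasDerivAt (fun y : ℝ => deriv ramp ((y - 1 / 2) / h))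
      (deriv (deriv ramp) ((y - 1 / 2) / h) * (1 / h)) y :=
    (hasDerivAt_deriv_ramp _).comp y (((hasDerivAt_id y).sub_const _).div_const h)
  have h₂ := ((h₁.const_mul (ε * h)).mul_const (W x)).const_add 1
  refine h₂.congr_deriv ?_
  have := H.h_pos.ne'
  field_simp

theorem hasDerivAt_cdf (H : Admissible ε h B W) (y x : ℝ) :
    HasDerivAt (fun y => perturbedCdf ε h W y x) (perturbedDensity ε h W y x) y := by
  have h₂ := (hasDerivAt_id y).add
    (((hasDerivAt_ramp_div (h := h) y).const_mul (ε * h ^ 2)).mul_const (W x))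
  refine h₂.congr_deriv ?_
  have := H.h_pos.ne'
  unfold perturbedDensity
  field_simp

/-- Since `h ≤ 1 / 2`, the endpoints of the unit interval lie where `ramp` vanishes. With `cdf_one`,
this keeps the total mass equal to `1`. -/
theorem cdf_zero (H : Admissible ε h B W) (x : ℝ) : perturbedCdf ε h W 0 x = 0 := by
  have : 1 ≤ |(0 - 1 / 2) / h| := by
    rw [abs_div, abs_of_pos H.h_pos, one_le_div H.h_pos]
    norm_num [abs_of_pos]
    linarith [H.h_le]
  rw [perturbedCdf, ramp_eq_zero this]
  ring

theorem cdf_one (H : Admissible ε h B W) (x : ℝ) : perturbedCdf ε h W 1 x = 1 := by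
  have : 1 ≤ |(1 - 1 / 2) / h| := by
    rw [abs_div, abs_of_pos H.h_pos, one_le_div H.h_pos]
    norm_num [abs_of_pos]
    linarith [H.h_le]
  rw [perturbedCdf, ramp_eq_zero this]
  ring

theorem integral_density (H : Admissible ε h B W) (y x : ℝ) :
    ∫ t in (0 : ℝ)..y, perturbedDensity ε h W t x = perturbedCdf ε h W y x := by
  rw [intervalIntegral.integral_eq_sub_of_hasDerivAt (fun t _ => H.hasDerivAt_cdf t x)
    ((H.continuous_density_left x).intervalIntegrable _ _), H.cdf_zero, sub_zero]

theorem hasDerivAt_rev (H : Admissible ε h B W) (y x : ℝ) :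
    HasDerivAt (fun y => perturbedRev ε h W y x)
      (1 - perturbedCdf ε h W y x - y * perturbedDensity ε h W y x) y := by
  refine (((H.hasDerivAt_cdf y x).const_sub 1).mul (hasDerivAt_id y)).congr_deriv ?_
  simp only [id]
  ring

theorem hasDerivAt_deriv_rev (H : Admissible ε h B W) (y x : ℝ) :
    HasDerivAt (deriv (fun y => perturbedRev ε h W y x))
      (-2 * perturbedDensity ε h W y x -
        y * (ε * deriv (deriv ramp) ((y - 1 / 2) / h) * W x)) y := by
  have : deriv (fun y => perturbedRev ε h W y x) = fun y =>
      1 - perturbedCdf ε h W y x - y * perturbedDensity ε h W y x :=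
    funext fun y => (H.hasDerivAt_rev y x).deriv
  rw [this]
  refine (((H.hasDerivAt_cdf y x).const_sub 1).sub
    ((hasDerivAt_id y).mul (H.hasDerivAt_density y x))).congr_deriv ?_
  simp only [id]
  ring

theorem abs_deriv_density_le (H : Admissible ε h B W) (y x : ℝ) :
    |ε * deriv (deriv ramp) ((y - 1 / 2) / h) * W x| ≤ ε * B := by
  rw [abs_mul, abs_mul, abs_of_pos H.eps_pos]
  calc _ ≤ ε * B * 1 := by
        have := H.eps_pos
        have := H.bound_pos
        gcongr
        · exact H.isCutoffBound.deriv2_ramp_le _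
        · exact H.abs_wave_le_one x
    _ = _ := mul_one _

/-- The uniform revenue has second derivative `-2`, and the perturbation moves it by `O(ε)`
uniformly in `h`. Strict concavity, the curvature bound and the upper bound in the class all follow
from this one estimate. -/
theorem abs_deriv2_rev_add_two_le (H : Admissible ε h B W) {y : ℝ} (hy : y ∈ Set.Icc (0 : ℝ) 1)
    (x : ℝ) :
    |2 * perturbedDensity ε h W y x +
        y * (ε * deriv (deriv ramp) ((y - 1 / 2) / h) * W x) - 2| ≤ 2 * (ε * B ^ 2) := by
  have h₁ := H.abs_perturbation_le y x
  have h₂ : |y * (ε * deriv (deriv ramp) ((y - 1 / 2) / h) * W x)| ≤ ε * B := by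
    rw [abs_mul, abs_of_nonneg hy.1]
    exact (mul_le_of_le_one_left (abs_nonneg _) hy.2).trans (H.abs_deriv_density_le y x)
  have h₃ := H.eps_h_B_le
  have h₄ := H.eps_mul_le
  unfold perturbedDensity
  rw [abs_le] at h₁ h₂ ⊢
  constructor <;> linarith [h₁.1, h₁.2, h₂.1, h₂.2]

theorem strictConcaveOn_rev (H : Admissible ε h B W) (x : ℝ) :
    StrictConcaveOn ℝ (Set.Icc (0 : ℝ) 1) (fun y => perturbedRev ε h W y x) := by
  refine strictConcaveOn_of_deriv2_neg' (convex_Icc 0 1)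
    (fun y _ => (H.hasDerivAt_rev y x).continuousAt.continuousWithinAt) fun y hy => ?_
  have h₁ : deriv^[2] (fun y => perturbedRev ε h W y x) y = _ := (H.hasDerivAt_deriv_rev y x).deriv
  rw [h₁]
  have := (abs_le.1 (H.abs_deriv2_rev_add_two_le hy x)).1
  linarith [H.eps_le]

theorem abs_amplitude_le (H : Admissible ε h B W) (x : ℝ) : |ε * h * W x| ≤ h / 4 := by
  have h₀ := mul_pos H.eps_pos H.h_pos
  rw [abs_mul, abs_of_pos h₀]
  calc _ ≤ ε * h * 1 := by gcongr; exact H.abs_wave_le_one x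
    _ ≤ h / 4 := by nlinarith [mul_nonneg H.h_pos.le (sub_nonneg.2 H.eps_le_quarter)]

theorem one_add_amplitude_pos (H : Admissible ε h B W) (x : ℝ) : 1 / 2 ≤ 1 + ε * h * W x := by
  linarith [(abs_le.1 (H.abs_amplitude_le x)).1, H.h_le]

/-- The maximizer stays in the zone where `ramp` is the identity. There the revenue is exactly
quadratic in the price, which is the source of the closed form `perturbedPrice`. -/
theorem abs_price_sub_lt (H : Admissible ε h B W) (x : ℝ) :
    |perturbedPrice ε h W x - 1 / 2| < h / 2 := by
  have h₁ := H.one_add_amplitude_pos x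
  have h₂ := H.abs_amplitude_le x
  have h₃ := H.h_pos
  have : perturbedPrice ε h W x - 1 / 2 = -(ε * h * W x) / (4 * (1 + ε * h * W x)) := by
    unfold perturbedPrice
    have : (1 + ε * h * W x) ≠ 0 := by linarith
    field_simp
    ring
  rw [this, abs_div, abs_neg, abs_of_pos (by linarith : 0 < 4 * (1 + ε * h * W x)),
    div_lt_iff₀ (by linarith)]
  nlinarith

theorem price_mem (H : Admissible ε h B W) (x : ℝ) :
    perturbedPrice ε h W x ∈ Set.Ioo (0 : ℝ) 1 := by
  have h₁ := abs_lt.1 (H.abs_price_sub_lt x)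
  have h₂ := H.h_le
  constructor <;> linarith [h₁.1, h₁.2]

theorem measurable_price (H : Admissible ε h B W) : Measurable (perturbedPrice ε h W) := by
  have h₂ : Measurable W := H.contDiff.continuous.measurable
  unfold perturbedPrice
  fun_prop

/-- Near the candidate price `ramp` is the identity, so the first-order condition can be checked
explicitly. Concavity on the whole interval turns the critical point into a global maximum. -/
theorem isMaxOn_price (H : Admissible ε h B W) (x : ℝ) :
    IsMaxOn (fun y => perturbedRev ε h W y x) (Set.Icc (0 : ℝ) 1) (perturbedPrice ε h W x) := by
  set p := perturbedPrice ε h W x with hp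
  have hpI := H.price_mem x
  have hu : |(p - 1 / 2) / h| < 1 / 2 := by
    rw [abs_div, abs_of_pos H.h_pos, div_lt_iff₀ H.h_pos]
    linarith [H.abs_price_sub_lt x]
  have hd : deriv ramp ((p - 1 / 2) / h) = 1 := by
    have : ramp =ᶠ[nhds ((p - 1 / 2) / h)] id := by
      have : ∀ᶠ u in nhds ((p - 1 / 2) / h), |u| < 1 / 2 :=
        continuous_abs.continuousAt.eventually (gt_mem_nhds hu)
      exact this.mono fun u hu => ramp_eq_self hu.le
    rw [this.deriv_eq]
    simp
  have hcrit : HasDerivAt (fun y => perturbedRev ε h W y x) 0 p := by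
    convert H.hasDerivAt_rev p x using 1
    rw [perturbedCdf, perturbedDensity, ramp_eq_self hu.le, hd, hp, perturbedPrice]
    have h₁ : (1 + ε * h * W x) ≠ 0 := by linarith [H.one_add_amplitude_pos x]
    have h₂ := H.h_pos.ne'
    field_simp
    ring
  have hconc := (H.strictConcaveOn_rev x).concaveOn
  intro y hy
  have hpI' : p ∈ Set.Icc (0 : ℝ) 1 := Set.Ioo_subset_Icc_self hpI
  rcases lt_trichotomy y p with hlt | heq | hgt
  · have := hconc.le_slope_of_hasDerivAt hy hpI' hlt hcrit
    rw [slope_def_field, le_div_iff₀ (sub_pos.2 hlt)] at this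
    simp only [Set.mem_ofPred_eq]
    linarith
  · simp [heq]
  · have := hconc.slope_le_of_hasDerivAt hpI' hy hgt hcrit
    rw [slope_def_field, div_le_iff₀ (sub_pos.2 hgt)] at this
    simp only [Set.mem_ofPred_eq]
    linarith

/-- The joint distribution with conditional density `perturbedDensity` and a uniform covariate. -/
def jointDist (H : Admissible ε h B W) : JointDist where
  cond := perturbedDensity ε h W
  marg := fun _ => 1
  measurable_cond := H.continuous_density.measurable
  measurable_marg := measurable_const
  cond_nonneg := fun y _ x _ => by linarith [H.density_ge y x]
  marg_nonneg := fun _ _ => zero_le_one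
  cond_integral := fun x _ => by rw [H.integral_density, H.cdf_one]
  marg_integral := by simp

theorem jointDist_cdf (H : Admissible ε h B W) : H.jointDist.cdf = perturbedCdf ε h W := by
  ext y x
  exact H.integral_density y x

theorem jointDist_rev (H : Admissible ε h B W) : H.jointDist.rev = perturbedRev ε h W := by
  ext y x
  rw [JointDist.rev, H.jointDist_cdf, perturbedRev]

/-- Revenue vanishes at both endpoints, while at `1/2` it equals `1/4` for every perturbation
because `ramp 0 = 0`. -/
theorem isOptimalPrice_mem (H : Admissible ε h B W) {x p : ℝ}
    (hp : H.jointDist.IsOptimalPrice x p) : p ∈ Set.Ioo (0 : ℝ) 1 := by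
  obtain ⟨hpI, hmax⟩ := hp
  rw [H.jointDist_rev] at hmax
  have hhalf : perturbedRev ε h W (1 / 2) x = 1 / 4 := by
    rw [perturbedRev, perturbedCdf, sub_self, zero_div, ramp_eq_self (by norm_num)]
    norm_num
  have h₁ : perturbedRev ε h W (1 / 2) x ≤ perturbedRev ε h W p x :=
    hmax (a := 1 / 2) ⟨by norm_num, by norm_num⟩
  refine ⟨lt_of_le_of_ne hpI.1 ?_, lt_of_le_of_ne hpI.2 ?_⟩
  · rintro rfl
    rw [hhalf, perturbedRev, mul_zero] at h₁
    norm_num at h₁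
  · rintro rfl
    rw [hhalf, perturbedRev, H.cdf_one] at h₁
    norm_num at h₁

/-- The three smallness conditions involve only `ε * B ^ 2`, never `h`, so the bandwidth remains
free to shrink with the sample size. -/
theorem regular (H : Admissible ε h B W) {C₀ Cstar Cbar Cmarg cmarg : ℝ}
    (h₀ : ε * B ^ 2 ≤ C₀) (h₁ : 2 * (ε * B ^ 2) ≤ 2 - Cstar) (h₂ : 2 * (ε * B ^ 2) ≤ Cbar - 2)
    (hcmarg : cmarg ≤ 1) (hCmarg : 1 ≤ Cmarg) :
    Regular C₀ Cstar Cbar Cmarg cmarg H.jointDist where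
  lipschitz := fun y _ y' _ x _ => by
    have : LipschitzWith (ε * B).toNNReal (fun y => perturbedDensity ε h W y x) := by
      refine lipschitzWith_of_nnnorm_deriv_le
        (fun y => (H.hasDerivAt_density y x).differentiableAt) fun y => ?_
      rw [(H.hasDerivAt_density y x).deriv, ← NNReal.coe_le_coe, coe_nnnorm, Real.norm_eq_abs]
      exact (H.abs_deriv_density_le y x).trans (Real.le_coe_toNNReal _)
    have h := this.dist_le_mul y y'
    rw [Real.coe_toNNReal _ (mul_nonneg H.eps_pos.le
      (zero_le_one.trans H.isCutoffBound.one_le)), Real.dist_eq, Real.dist_eq] at h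
    exact h.trans (mul_le_mul_of_nonneg_right (H.eps_mul_le.trans h₀) (abs_nonneg _))
  concave := fun x _ => by
    rw [H.jointDist_rev]
    exact H.strictConcaveOn_rev x
  strong := fun x _ => by
    refine (ae_restrict_mem measurableSet_Icc).mono fun y hy => ?_
    have h₃ : deriv (fun t => H.jointDist.cond t x) y = _ := (H.hasDerivAt_density y x).deriv
    rw [h₃]
    have := (abs_le.1 (H.abs_deriv2_rev_add_two_le hy x)).1
    change -2 * perturbedDensity ε h W y x - _ ≤ _
    linarith
  interior := fun x _ p hp => H.isOptimalPrice_mem hp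
  smooth := ⟨Set.univ, isOpen_univ, fun _ _ _ _ => Set.mem_univ _, H.contDiff_density.contDiffOn⟩
  bounded_y := fun x _ => by
    refine (ae_restrict_mem measurableSet_Icc).mono fun y hy => ?_
    have h₃ : deriv (fun t => H.jointDist.cond t x) y = _ := (H.hasDerivAt_density y x).deriv
    rw [h₃]
    have := abs_le.1 (H.abs_deriv2_rev_add_two_le hy x)
    change |2 * perturbedDensity ε h W y x + _| ≤ _
    rw [abs_le]
    constructor <;> linarith [this.1, this.2]
  bounded_x := by
    refine (ae_restrict_mem (measurableSet_Icc.prod measurableSet_Icc)).mono fun z hz => ?_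
    obtain ⟨y, x⟩ := z
    have hW : HasDerivAt W (deriv W x) x := (H.contDiff.differentiable (by simp) x).hasDerivAt
    have hF : HasDerivAt (fun s => H.jointDist.cdf y s)
        (ε * h ^ 2 * ramp ((y - 1 / 2) / h) * deriv W x) x := by
      rw [H.jointDist_cdf]
      exact (hW.const_mul _).const_add y
    have hf : HasDerivAt (fun s => H.jointDist.cond y s)
        (ε * h * deriv ramp ((y - 1 / 2) / h) * deriv W x) x := (hW.const_mul _).const_add 1
    refine ⟨hF.differentiableAt, hf.differentiableAt, ?_⟩
    dsimp only
    rw [hF.deriv, hf.deriv]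
    have hy : y ∈ Set.Icc (0 : ℝ) 1 := hz.1
    have hε := H.eps_pos
    have hh := H.h_pos
    have hB := H.isCutoffBound.one_le
    have e₁ : |ε * h ^ 2 * ramp ((y - 1 / 2) / h) * deriv W x| ≤ ε * B ^ 2 := by
      rw [abs_mul, abs_mul, abs_of_pos (by positivity)]
      calc _ ≤ ε * h ^ 2 * B * (B / h) := by
            gcongr
            · exact H.isCutoffBound.ramp_le _
            · exact H.abs_deriv_le x
        _ = ε * B ^ 2 * h := by field_simp
        _ ≤ ε * B ^ 2 * 1 := by
            gcongr
            linarith [H.h_le]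
        _ = _ := mul_one _
    -- The critical term: the slope `B / h` of the wave exactly cancels the factor `h` of the
    -- amplitude. The product of the bound on `deriv ramp` and the bound on the slope is why `B`
    -- enters squared.
    have e₂ : |ε * h * deriv ramp ((y - 1 / 2) / h) * deriv W x| ≤ ε * B ^ 2 := by
      rw [abs_mul, abs_mul, abs_of_pos (by positivity)]
      calc _ ≤ ε * h * B * (B / h) := by
            gcongr
            · exact H.isCutoffBound.deriv_ramp_le _
            · exact H.abs_deriv_le x
        _ = _ := by field_simp
    calc _ ≤ _ := abs_add_le _ _
      _ ≤ ε * B ^ 2 + ε * B ^ 2 := by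
          refine add_le_add e₁ ?_
          rw [abs_mul, abs_of_nonneg hy.1]
          exact (mul_le_of_le_one_left (abs_nonneg _) hy.2).trans e₂
      _ ≤ Cbar := by linarith
  marg_bounds := fun _ _ => ⟨hcmarg, hCmarg⟩

end Admissible

/-! ### Product densities, affinity and Le Cam's two-point bound -/

theorem pi_withDensity_ofReal {α : Type*} [MeasurableSpace α] {μ : Measure α} [IsFiniteMeasure μ]
    {f : α → ℝ} (hf0 : ∀ a, 0 ≤ f a) (hf : Integrable f μ) (n : ℕ) :
    Measure.pi (fun _ : Fin n => μ.withDensity (fun a => ENNReal.ofReal (f a))) =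
      (Measure.pi (fun _ : Fin n => μ)).withDensity
        (fun d => ENNReal.ofReal (∏ i, f (d i))) := by
  refine Measure.pi_eq fun s hs => ?_
  rw [withDensity_apply _ (MeasurableSet.univ_pi hs), Measure.restrict_pi_pi,
    ← ofReal_integral_eq_lintegral_ofReal
      (Integrable.fintype_prod (fun i => hf.restrict (s := s i)))
      (.of_forall fun d => Finset.prod_nonneg fun i _ => hf0 _),
    integral_fintype_prod_eq_prod (fun _ => f),
    ENNReal.ofReal_prod_of_nonneg fun i _ => integral_nonneg hf0]
  refine Finset.prod_congr rfl fun i _ => ?_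
  rw [withDensity_apply _ (hs i),
    ← ofReal_integral_eq_lintegral_ofReal hf.restrict (.of_forall hf0)]

theorem integral_pi_withDensity_ofReal {α : Type*} [MeasurableSpace α] {μ : Measure α}
    [IsFiniteMeasure μ] {f : α → ℝ} (hfm : Measurable f) (hf0 : ∀ a, 0 ≤ f a)
    (hf : Integrable f μ) {n : ℕ} (g : (Fin n → α) → ℝ) :
    ∫ d, g d ∂(Measure.pi (fun _ : Fin n => μ.withDensity (fun a => ENNReal.ofReal (f a)))) =
      ∫ d, (∏ i, f (d i)) * g d ∂(Measure.pi (fun _ : Fin n => μ)) := by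
  rw [pi_withDensity_ofReal hf0 hf, integral_withDensity_eq_integral_toReal_smul
    (by fun_prop) (by simp)]
  simp_rw [ENNReal.toReal_ofReal (Finset.prod_nonneg fun i _ => hf0 _), smul_eq_mul]

/-- The affinity of two densities that are bounded from below, in terms of their quadratic
distance. -/
theorem half_le_affinity_pow {α : Type*} [MeasurableSpace α] {μ : Measure α} [IsProbabilityMeasure μ]
    {f g : α → ℝ} (hf : Measurable f) (hg : Measurable g) (hf1 : ∀ a, 1 / 2 ≤ f a)
    (hg1 : ∀ a, 1 / 2 ≤ g a) (hf2 : ∀ a, f a ≤ 2) (hg2 : ∀ a, g a ≤ 2)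
    (hfi : ∫ a, f a ∂μ = 1) (hgi : ∫ a, g a ∂μ = 1) {n : ℕ}
    (hn : n * ∫ a, (f a - g a) ^ 2 ∂μ ≤ 1) :
    1 / 2 ≤ (∫ a, √(f a * g a) ∂μ) ^ n := by
  -- The hypothesis says nothing about the distance when `n = 0`; for `n ≥ 1` it yields `D ≤ 1`,
  -- which keeps the base `1 - D / 2` nonnegative below.
  rcases Nat.eq_zero_or_pos n with rfl | hpos
  · norm_num
  have If : Integrable f μ := .of_bound hf.aestronglyMeasurable 2 (.of_forall fun a => by
    rw [Real.norm_eq_abs, abs_le]; constructor <;> linarith [hf1 a, hf2 a])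
  have Ig : Integrable g μ := .of_bound hg.aestronglyMeasurable 2 (.of_forall fun a => by
    rw [Real.norm_eq_abs, abs_le]; constructor <;> linarith [hg1 a, hg2 a])
  have Id : Integrable (fun a => (f a - g a) ^ 2) μ := .of_bound
    ((hf.sub hg).pow_const 2).aestronglyMeasurable 4 (.of_forall fun a => by
      rw [Real.norm_eq_abs, abs_of_nonneg (sq_nonneg _)]
      nlinarith [hf1 a, hg1 a, hf2 a, hg2 a])
  have Is : Integrable (fun a => √(f a * g a)) μ := .of_bound
    (hf.mul hg).sqrt.aestronglyMeasurable 2 (.of_forall fun a => by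
      rw [Real.norm_eq_abs, abs_of_nonneg (Real.sqrt_nonneg _)]
      refine Real.sqrt_le_iff.2 ⟨by norm_num, ?_⟩
      nlinarith [hf1 a, hg1 a, hf2 a, hg2 a])
  have key : ∀ a, (f a + g a) / 2 - (f a - g a) ^ 2 / 2 ≤ √(f a * g a) := fun a => by
    refine Real.le_sqrt_of_sq_le ?_
    -- After squaring, the claim is that `(f - g) ^ 2 / 4` times this quantity is nonnegative; the
    -- lower bound `1/2` on both densities enters here.
    have h₁ : 0 ≤ 2 * (f a + g a) - 1 - (f a - g a) ^ 2 := by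
      nlinarith [mul_nonneg (sub_nonneg.2 (hf1 a)) (sub_nonneg.2 (hf2 a)),
        mul_nonneg (sub_nonneg.2 (hg1 a)) (sub_nonneg.2 (hg2 a)),
        mul_nonneg (sub_nonneg.2 (hf1 a)) (sub_nonneg.2 (hg1 a)), hf1 a, hg1 a]
    nlinarith [mul_nonneg (sq_nonneg (f a - g a)) h₁]
  have Ifg : Integrable (fun a => f a + g a) μ := If.add Ig
  set D := ∫ a, (f a - g a) ^ 2 ∂μ with hD
  have h₁ : 1 - D / 2 ≤ ∫ a, √(f a * g a) ∂μ := by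
    have := integral_mono ((Ifg.div_const 2).sub (Id.div_const 2)) Is key
    have e : ∫ a, ((f a + g a) / 2 - (f a - g a) ^ 2 / 2) ∂μ = 1 - D / 2 := by
      rw [integral_sub (Ifg.div_const 2) (Id.div_const 2), integral_div, integral_div,
        integral_add If Ig, hfi, hgi, ← hD]
      norm_num
    exact e ▸ this
  have hn1 : (1 : ℝ) ≤ n := by exact_mod_cast hpos
  have hD0 : 0 ≤ D := integral_nonneg fun a => sq_nonneg _
  have hD1 : D ≤ 1 := by nlinarith
  -- Bernoulli's inequality passes from one observation to `n`.
  have h₂ := one_add_mul_le_pow (a := -(D / 2)) (by linarith) n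
  calc (1 / 2 : ℝ) ≤ 1 + n * -(D / 2) := by linarith
    _ ≤ (1 + -(D / 2)) ^ n := h₂
    _ ≤ _ := pow_le_pow_left₀ (by linarith) (by linarith) n

/-- Completing the square in `√a` and `√b`. Being linear in `√(a * b)`, `a` and `b`, the bound
integrates termwise. For probability densities of affinity at least `1/2` it leaves `1/4 - 1/8 =
1/8`. -/
theorem sqrt_half_sub_le_min {a b : ℝ} (ha : 0 ≤ a) (hb : 0 ≤ b) :
    √(a * b) / 2 - (a + b) / 16 ≤ min a b := by
  rw [Real.sqrt_mul ha]
  have h₁ := Real.sq_sqrt ha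
  have h₂ := Real.sq_sqrt hb
  refine le_min ?_ ?_
  · nlinarith [sq_nonneg (√b - 4 * √a)]
  · nlinarith [sq_nonneg (√a - 4 * √b)]

/-- Le Cam's two-point bound: two nonnegative losses whose sum is at least `Δ` cannot both be small
in the mean under two product measures of affinity at least `1 / 2`. -/
theorem le_two_point_loss {α : Type*} [MeasurableSpace α] {μ : Measure α} [IsProbabilityMeasure μ]
    {f g : α → ℝ} (If : Integrable f μ) (Ig : Integrable g μ) (hf0 : ∀ a, 0 ≤ f a)
    (hg0 : ∀ a, 0 ≤ g a) (hfi : ∫ a, f a ∂μ = 1) (hgi : ∫ a, g a ∂μ = 1)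
    (Is : Integrable (fun a => √(f a * g a)) μ) {n : ℕ}
    (haff : 1 / 2 ≤ (∫ a, √(f a * g a) ∂μ) ^ n) {A A' : (Fin n → α) → ℝ} {Δ : ℝ} (hΔ : 0 ≤ Δ)
    (hA : ∀ d, 0 ≤ A d) (hA' : ∀ d, 0 ≤ A' d) (hAA : ∀ d, Δ ≤ A d + A' d)
    (IA : Integrable (fun d => (∏ i, f (d i)) * A d) (Measure.pi fun _ => μ))
    (IA' : Integrable (fun d => (∏ i, g (d i)) * A' d) (Measure.pi fun _ => μ)) :
    Δ / 8 ≤ ∫ d, (∏ i, f (d i)) * A d ∂(Measure.pi fun _ => μ) +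
      ∫ d, (∏ i, g (d i)) * A' d ∂(Measure.pi fun _ => μ) := by
  have Jf : Integrable (fun d : Fin n → α => ∏ i, f (d i)) (Measure.pi fun _ => μ) :=
    .fintype_prod (fun _ => If)
  have Jg : Integrable (fun d : Fin n → α => ∏ i, g (d i)) (Measure.pi fun _ => μ) :=
    .fintype_prod (fun _ => Ig)
  have Jfg : Integrable (fun d : Fin n → α => (∏ i, f (d i)) + ∏ i, g (d i))
      (Measure.pi fun _ => μ) := Jf.add Jg
  have Js : Integrable (fun d : Fin n → α => ∏ i, √(f (d i) * g (d i))) (Measure.pi fun _ => μ) :=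
    .fintype_prod (fun _ => Is)
  have key : ∀ d : Fin n → α, Δ * ((∏ i, √(f (d i) * g (d i))) / 2 -
      ((∏ i, f (d i)) + ∏ i, g (d i)) / 16) ≤
      (∏ i, f (d i)) * A d + (∏ i, g (d i)) * A' d := fun d => by
    have p₁ : 0 ≤ ∏ i, f (d i) := Finset.prod_nonneg fun i _ => hf0 _
    have p₂ : 0 ≤ ∏ i, g (d i) := Finset.prod_nonneg fun i _ => hg0 _
    have h₁ := sqrt_half_sub_le_min p₁ p₂
    rw [← Finset.prod_mul_distrib, Real.sqrt_prod _ fun i _ => mul_nonneg (hf0 _) (hg0 _)] at h₁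
    calc _ ≤ Δ * min (∏ i, f (d i)) (∏ i, g (d i)) := mul_le_mul_of_nonneg_left h₁ hΔ
      _ ≤ (A d + A' d) * min (∏ i, f (d i)) (∏ i, g (d i)) :=
        mul_le_mul_of_nonneg_right (hAA d) (le_min p₁ p₂)
      _ = min (∏ i, f (d i)) (∏ i, g (d i)) * A d + min (∏ i, f (d i)) (∏ i, g (d i)) * A' d := by
        ring
      _ ≤ _ := add_le_add (mul_le_mul_of_nonneg_right (min_le_left _ _) (hA d))
        (mul_le_mul_of_nonneg_right (min_le_right _ _) (hA' d))
  have h₂ := integral_mono (((Js.div_const 2).sub (Jfg.div_const 16)).const_mul Δ)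
    (IA.add IA') key
  have e : ∫ d : Fin n → α, Δ * ((∏ i, √(f (d i) * g (d i))) / 2 -
      ((∏ i, f (d i)) + ∏ i, g (d i)) / 16) ∂(Measure.pi fun _ => μ) =
      Δ * ((∫ a, √(f a * g a) ∂μ) ^ n / 2 - 1 / 8) := by
    rw [integral_const_mul, integral_sub (Js.div_const 2) (Jfg.div_const 16),
      integral_div, integral_div, integral_add Jf Jg,
      integral_fintype_prod_eq_pow (fun a => √(f a * g a)), integral_fintype_prod_eq_pow f,
      integral_fintype_prod_eq_pow g, hfi, hgi, Fintype.card_fin]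
    norm_num
  have h₃ : Δ * ((∫ a, √(f a * g a) ∂μ) ^ n / 2 - 1 / 8) ≤
      ∫ d, ((∏ i, f (d i)) * A d + (∏ i, g (d i)) * A' d) ∂(Measure.pi fun _ => μ) := e ▸ h₂
  rw [integral_add IA IA'] at h₃
  refine le_trans ?_ h₃
  nlinarith

/-! ### Forgone revenue and its relation to the deficiency -/

/-- The uniform distribution on the unit square. -/
def uniformSquare : Measure (ℝ × ℝ) :=
  volume.restrict (Set.Icc (0 : ℝ) 1 ×ˢ Set.Icc (0 : ℝ) 1)

theorem uniformSquare_eq_prod : uniformSquare =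
    (volume.restrict (Set.Icc (0 : ℝ) 1)).prod (volume.restrict (Set.Icc (0 : ℝ) 1)) := by
  rw [uniformSquare, Measure.prod_restrict]
  rfl

instance : IsProbabilityMeasure uniformSquare := by
  have : IsProbabilityMeasure (volume.restrict (Set.Icc (0 : ℝ) 1)) := ⟨by simp⟩
  rw [uniformSquare_eq_prod]
  infer_instance

namespace Admissible

variable {ε h B : ℝ} {W W' : ℝ → ℝ}

theorem integrable_density (H : Admissible ε h B W) :
    Integrable (fun z : ℝ × ℝ => perturbedDensity ε h W z.1 z.2) uniformSquare :=
  .of_bound H.continuous_density.aestronglyMeasurable 2 (.of_forall fun z => by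
    rw [Real.norm_eq_abs, abs_of_nonneg (by linarith [H.density_ge z.1 z.2])]
    exact H.density_le _ _)

theorem integral_density_uniformSquare (H : Admissible ε h B W) :
    ∫ z, perturbedDensity ε h W z.1 z.2 ∂uniformSquare = 1 := by
  have hi := H.integrable_density
  rw [uniformSquare_eq_prod] at hi ⊢
  rw [integral_prod_symm _ hi]
  have : ∀ x, ∫ y in Set.Icc (0 : ℝ) 1, perturbedDensity ε h W y x = 1 := fun x => by
    rw [integral_Icc_eq_integral_Ioc, ← intervalIntegral.integral_of_le zero_le_one,
      H.integral_density, H.cdf_one]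
  simp [this]

theorem integral_pi_law (H : Admissible ε h B W) {n : ℕ} (g : (Fin n → ℝ × ℝ) → ℝ) :
    ∫ d, g d ∂(Measure.pi fun _ : Fin n => H.jointDist.law) =
      ∫ d, (∏ i, perturbedDensity ε h W (d i).1 (d i).2) * g d
        ∂(Measure.pi fun _ : Fin n => uniformSquare) := by
  have : H.jointDist.law = uniformSquare.withDensity
      (fun z => ENNReal.ofReal (perturbedDensity ε h W z.1 z.2)) := by
    simp [JointDist.law, jointDist, uniformSquare]
  rw [this]
  exact integral_pi_withDensity_ofReal H.continuous_density.measurable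
    (fun z => by linarith [H.density_ge z.1 z.2]) H.integrable_density g

theorem abs_rev_le (H : Admissible ε h B W) {y : ℝ} (hy : y ∈ Set.Icc (0 : ℝ) 1) (x : ℝ) :
    |perturbedRev ε h W y x| ≤ 3 := by
  have hε := H.eps_pos
  have hh := H.h_pos
  have hB := H.bound_pos
  have e₁ : |ε * h ^ 2 * ramp ((y - 1 / 2) / h) * W x| ≤ 1 := by
    rw [abs_mul, abs_mul, abs_of_pos (by positivity : 0 < ε * h ^ 2)]
    calc _ ≤ ε * 1 ^ 2 * B * 1 := by
          gcongr
          · linarith [H.h_le]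
          · exact H.isCutoffBound.ramp_le _
          · exact H.abs_wave_le_one x
      _ ≤ 1 := by linarith [H.eps_mul_le, H.eps_le]
  rw [perturbedRev, abs_mul, abs_of_nonneg hy.1, perturbedCdf]
  refine (mul_le_of_le_one_right (abs_nonneg _) hy.2).trans ?_
  rw [abs_le] at e₁ ⊢
  constructor <;> linarith [e₁.1, e₁.2, hy.1, hy.2]

/-- The revenue forgone at the covariate value `x` by charging `y`. -/
def loss (_ : Admissible ε h B W) (y x : ℝ) : ℝ :=
  perturbedRev ε h W (perturbedPrice ε h W x) x - perturbedRev ε h W y x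

theorem loss_nonneg (H : Admissible ε h B W) {y : ℝ} (hy : y ∈ Set.Icc (0 : ℝ) 1) (x : ℝ) :
    0 ≤ H.loss y x :=
  sub_nonneg.2 (H.isMaxOn_price x hy)

theorem abs_loss_le (H : Admissible ε h B W) {y : ℝ} (hy : y ∈ Set.Icc (0 : ℝ) 1) (x : ℝ) :
    |H.loss y x| ≤ 6 := by
  have h₁ := abs_le.1 (H.abs_rev_le hy x)
  have h₂ := abs_le.1 (H.abs_rev_le (Set.Ioo_subset_Icc_self (H.price_mem x)) x)
  rw [loss, abs_le]
  constructor <;> linarith [h₁.1, h₁.2, h₂.1, h₂.2]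

theorem measurable_loss (H : Admissible ε h B W) {α : Type*} [MeasurableSpace α] {p x : α → ℝ}
    (hp : Measurable p) (hx : Measurable x) : Measurable (fun a => H.loss (p a) (x a)) :=
  (H.continuous_rev.measurable.comp ((H.measurable_price.comp hx).prodMk hx)).sub
    (H.continuous_rev.measurable.comp (hp.prodMk hx))

/-- Where two perturbations have opposite unit amplitudes, no price is good for both. -/
theorem le_loss_add_loss (H : Admissible ε h B W) (H' : Admissible ε h B W') {x s : ℝ}
    (hs : s ^ 2 = 1) (hW : W x = s) (hW' : W' x = -s) (y : ℝ) :
    ε ^ 2 * h ^ 2 / 8 ≤ H.loss y x + H'.loss y x := by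
  have hε := H.eps_pos
  have hε4 := H.eps_le_quarter
  have hh := H.h_pos
  have hh2 := H.h_le
  have hs1 : |s| = 1 := 
    (pow_eq_one_iff_of_nonneg (abs_nonneg s) two_ne_zero).1 (by rw [sq_abs, hs])
  have ht : |s * (ε / 4)| ≤ 1 / 2 := by
    rw [abs_mul, hs1, abs_of_pos (by positivity)]
    linarith
  have ht' : |-(s * (ε / 4))| ≤ 1 / 2 := by rwa [abs_neg]
  have hth : |s * (ε / 4) * h| ≤ 1 / 2 := by
    rw [abs_mul, abs_of_pos hh]
    nlinarith [abs_nonneg (s * (ε / 4))]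
  have b := abs_le.1 hth
  -- The prices `1/2 ∓ s * ε * h / 4` are the maximizers to first order. Testing against them avoids
  -- the fraction in the exact maximizer; their revenues add up to `1/2 + ε ^ 2 * h ^ 2 / 8`.
  have h₁ : perturbedRev ε h W (1 / 2 + -(s * (ε / 4)) * h) x ≤
      perturbedRev ε h W (perturbedPrice ε h W x) x :=
    H.isMaxOn_price x (a := 1 / 2 + -(s * (ε / 4)) * h) ⟨by linarith, by linarith⟩
  have h₂ : perturbedRev ε h W' (1 / 2 + s * (ε / 4) * h) x ≤
      perturbedRev ε h W' (perturbedPrice ε h W' x) x :=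
    H'.isMaxOn_price x (a := 1 / 2 + s * (ε / 4) * h) ⟨by linarith, by linarith⟩
  have e₁ : (1 / 2 + -(s * (ε / 4)) * h - 1 / 2) / h = -(s * (ε / 4)) := by field_simp; ring
  have e₂ : (1 / 2 + s * (ε / 4) * h - 1 / 2) / h = s * (ε / 4) := by field_simp; ring
  have c₁ : perturbedRev ε h W (1 / 2 + -(s * (ε / 4)) * h) x =
      1 / 4 - s ^ 2 * (ε / 4 * h) ^ 2 +
        (1 / 2 - s * (ε / 4) * h) * (ε * h ^ 2 * (s ^ 2 * (ε / 4))) := by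
    rw [perturbedRev, perturbedCdf, e₁, ramp_eq_self ht', hW]
    ring
  have c₂ : perturbedRev ε h W' (1 / 2 + s * (ε / 4) * h) x =
      1 / 4 - s ^ 2 * (ε / 4 * h) ^ 2 +
        (1 / 2 + s * (ε / 4) * h) * (ε * h ^ 2 * (s ^ 2 * (ε / 4))) := by
    rw [perturbedRev, perturbedCdf, e₂, ramp_eq_self ht, hW']
    ring
  -- Opposite amplitudes cancel in the sum, so any common price earns at most `1/2` in total.
  have c₃ : perturbedRev ε h W y x + perturbedRev ε h W' y x = 2 * (y * (1 - y)) := by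
    rw [perturbedRev, perturbedCdf, perturbedRev, perturbedCdf, hW, hW']
    ring
  rw [hs] at c₁ c₂
  unfold loss
  nlinarith [sq_nonneg (y - 1 / 2)]

/-- The mean deficiency of a data-based pricing function is at least its mean integrated loss. -/
theorem integral_loss_le (H : Admissible ε h B W) {n : ℕ} (q : DataPricing n) :
    ∫ d, (∏ i, perturbedDensity ε h W (d i).1 (d i).2) *
        (∫ x in Set.Ioc (0 : ℝ) 1, H.loss (q.price d x) x)
        ∂(Measure.pi fun _ : Fin n => uniformSquare) ≤
      H.jointDist.optimalRevenue - H.jointDist.meanRevenue q := by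
  have hrev : ∀ p, H.jointDist.revenue p = ∫ x in Set.Ioc (0 : ℝ) 1, perturbedRev ε h W (p x) x := by
    intro p
    rw [JointDist.revenue, intervalIntegral.integral_of_le zero_le_one, H.jointDist_rev]
    simp [jointDist]
  have hint : ∀ p : ℝ → ℝ, Measurable p → (∀ x ∈ Set.Icc (0 : ℝ) 1, p x ∈ Set.Icc (0 : ℝ) 1) →
      IntegrableOn (fun x => perturbedRev ε h W (p x) x) (Set.Ioc (0 : ℝ) 1) := by
    intro p hp hpm
    refine Integrable.of_bound
      (H.continuous_rev.measurable.comp (hp.prodMk measurable_id)).aestronglyMeasurable 3 ?_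
    exact (ae_restrict_mem measurableSet_Ioc).mono fun x hx =>
      H.abs_rev_le (hpm x (Set.Ioc_subset_Icc_self hx)) x
  have hint0 := hint _ H.measurable_price fun x _ => Set.Ioo_subset_Icc_self (H.price_mem x)
  have hopt : H.jointDist.revenue (perturbedPrice ε h W) ≤ H.jointDist.optimalRevenue := by
    refine le_csSup ⟨H.jointDist.revenue (perturbedPrice ε h W), ?_⟩
      ⟨_, ⟨H.measurable_price, fun x _ => Set.Ioo_subset_Icc_self (H.price_mem x)⟩, rfl⟩
    rintro _ ⟨p, ⟨hp, hpm⟩, rfl⟩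
    rw [hrev, hrev]
    exact setIntegral_mono_on (hint p hp hpm) hint0 measurableSet_Ioc fun x hx =>
      H.isMaxOn_price x (hpm x (Set.Ioc_subset_Icc_self hx))
  have hq : ∀ d, Measurable (q.price d) := fun d =>
    q.measurable_price.comp measurable_prodMk_left
  have hloss : ∀ d, ∫ x in Set.Ioc (0 : ℝ) 1, H.loss (q.price d x) x =
      H.jointDist.revenue (perturbedPrice ε h W) - H.jointDist.revenue (q.price d) := by
    intro d
    rw [hrev, hrev]
    exact integral_sub hint0 (hint _ (hq d) (q.price_mem d))
  have hL : Integrable (fun d : Fin n → ℝ × ℝ => ∏ i, perturbedDensity ε h W (d i).1 (d i).2)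
      (Measure.pi fun _ => uniformSquare) :=
    .fintype_prod (f := fun _ (z : ℝ × ℝ) => perturbedDensity ε h W z.1 z.2)
      (fun _ => H.integrable_density)
  have hL1 : ∫ d : Fin n → ℝ × ℝ, ∏ i, perturbedDensity ε h W (d i).1 (d i).2
      ∂(Measure.pi fun _ => uniformSquare) = 1 := by
    rw [integral_fintype_prod_eq_pow (fun z : ℝ × ℝ => perturbedDensity ε h W z.1 z.2),
      H.integral_density_uniformSquare, one_pow]
  -- Joint measurability of the price in data and covariate is what makes the integrated revenue
  -- measurable in the data.
  have hmeas : Measurable (fun d => H.jointDist.revenue (q.price d)) := by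
    simp_rw [hrev]
    have : Measurable (fun z : (Fin n → ℝ × ℝ) × ℝ => perturbedRev ε h W (q.price z.1 z.2) z.2) :=
      H.continuous_rev.measurable.comp (q.measurable_price.prodMk measurable_snd)
    exact (this.stronglyMeasurable.integral_prod_right
      (ν := volume.restrict (Set.Ioc (0 : ℝ) 1))).measurable
  have hbound : ∀ d, ‖H.jointDist.revenue (q.price d)‖ ≤ 3 := by
    intro d
    rw [hrev]
    have := norm_setIntegral_le_of_norm_le_const (μ := volume) (s := Set.Ioc (0 : ℝ) 1)
      (f := fun x => perturbedRev ε h W (q.price d x) x) (C := 3) (by simp) fun x hx =>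
        H.abs_rev_le (q.price_mem d x (Set.Ioc_subset_Icc_self hx)) x
    simpa using this
  have hLR := hL.mul_bdd hmeas.aestronglyMeasurable (.of_forall hbound)
  simp_rw [hloss, mul_sub]
  rw [integral_sub (hL.mul_const _) hLR, integral_mul_const, hL1, one_mul,
    JointDist.meanRevenue, H.integral_pi_law]
  exact sub_le_sub_right hopt _

end Admissible

/-! ### The hypercube of signs and the cells of the covariate -/

/-- The amplitudes `1` and `-1` as encoded by booleans. -/
def signs {m : ℕ} (ω : Fin m → Bool) (k : Fin m) : ℝ := if ω k then 1 else -1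

/-- A vertex of the hypercube with one coordinate flipped. -/
def flip {m : ℕ} (k : Fin m) (ω : Fin m → Bool) : Fin m → Bool := Function.update ω k (!ω k)

section signs
variable {m : ℕ}

theorem flip_flip (k : Fin m) (ω : Fin m → Bool) : flip k (flip k ω) = ω := by
  simp [flip]

theorem signs_sq (ω : Fin m → Bool) (k : Fin m) : signs ω k ^ 2 = 1 := by
  unfold signs
  split_ifs <;> norm_num

theorem abs_signs (ω : Fin m → Bool) (k : Fin m) : |signs ω k| = 1 := by
  unfold signs
  split_ifs <;> norm_num

theorem signs_flip_self (k : Fin m) (ω : Fin m → Bool) : signs (flip k ω) k = -signs ω k := by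
  cases h : ω k <;> simp [signs, flip, h]

theorem signs_flip_of_ne {k j : Fin m} (hj : j ≠ k) (ω : Fin m → Bool) :
    signs (flip k ω) j = signs ω j := by
  simp [signs, flip, hj]

/-- Assouad's averaging argument over the vertices of the hypercube. -/
theorem exists_half_le_sum {T : Fin m → (Fin m → Bool) → ℝ} {τ : ℝ}
    (hT : ∀ k ω, τ ≤ T k ω + T k (flip k ω)) : ∃ ω, m * τ / 2 ≤ ∑ k, T k ω := by
  have hk : ∀ k, ∑ _ω : Fin m → Bool, τ / 2 ≤ ∑ ω, T k ω := by
    intro k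
    -- Flipping is an involution, so each of the two terms contributes equally to the average over
    -- vertices.
    have h₁ : ∑ ω, T k (flip k ω) = ∑ ω, T k ω :=
      Equiv.sum_comp (Function.Involutive.toPerm (flip k) (flip_flip k)) (T k)
    have h₂ := Finset.sum_le_sum fun ω (_ : ω ∈ Finset.univ) => hT k ω
    rw [Finset.sum_add_distrib, h₁] at h₂
    rw [← Finset.sum_div]
    linarith
  obtain ⟨ω, -, hω⟩ := Finset.exists_le_of_sum_le (s := Finset.univ)
    (f := fun _ : Fin m → Bool => m * τ / 2) (g := fun ω => ∑ k, T k ω) Finset.univ_nonempty (by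
      rw [Finset.sum_comm]
      refine le_trans (le_of_eq ?_) (Finset.sum_le_sum fun k _ => hk k)
      simp only [Finset.sum_const, Finset.card_univ, Fintype.card_fin, nsmul_eq_mul]
      ring)
  exact ⟨ω, hω⟩

end signs

/-- The middle half of the `k`-th cell of length `2 * h`. -/
def cell (h : ℝ) (k : ℕ) : Set ℝ := Set.Icc ((2 * k + 1 / 2) * h) ((2 * k + 3 / 2) * h)

section cell
variable {h : ℝ}

theorem measurableSet_cell (k : ℕ) : MeasurableSet (cell h k) := measurableSet_Icc

/-- The cell is the plateau of its bump, so the wave there equals the sign exactly. -/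
theorem abs_sub_le_of_mem_cell (hh : 0 < h) {k : ℕ} {x : ℝ} (hx : x ∈ cell h k) :
    |x / h - (2 * k + 1)| ≤ 1 / 2 := by
  have h₁ := (le_div_iff₀ hh).2 hx.1
  have h₂ := (div_le_iff₀ hh).2 hx.2
  rw [abs_le]
  constructor <;> linarith

theorem disjoint_cell (hh : 0 < h) {i j : ℕ} (hij : i ≠ j) : Disjoint (cell h i) (cell h j) :=
  Set.disjoint_left.2 fun _ hi hj => hij <| eq_of_abs_sub_odd_lt_one
    ((abs_sub_le_of_mem_cell hh hi).trans_lt (by norm_num))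
    ((abs_sub_le_of_mem_cell hh hj).trans_lt (by norm_num))

theorem cell_subset (hh : 0 < h) {m : ℕ} (hm : 2 * m * h = 1) (k : Fin m) :
    cell h k ⊆ Set.Ioc (0 : ℝ) 1 := by
  intro x hx
  have hk : ((k : ℕ) : ℝ) + 1 ≤ m := by exact_mod_cast k.2
  refine ⟨lt_of_lt_of_le (by positivity) hx.1, hx.2.trans ?_⟩
  rw [← hm]
  gcongr
  linarith

theorem volume_real_cell (hh : 0 < h) (k : ℕ) : volume.real (cell h k) = h := by
  rw [cell, Real.volume_real_Icc_of_le (by gcongr; norm_num)]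
  ring

end cell

/-! ### Indistinguishability and loss on a single cell -/

namespace Admissible

variable {ε h B : ℝ}

theorem of_signs (hB : IsCutoffBound B) (hε : 0 < ε) (hεB : ε * B ^ 2 ≤ 1 / 4) (hh : 0 < h)
    (hh2 : h ≤ 1 / 2) {m : ℕ} (ω : Fin m → Bool) : Admissible ε h B (wave h (signs ω)) where
  isCutoffBound := hB
  eps_pos := hε
  eps_le := hεB
  h_pos := hh
  h_le := hh2
  contDiff := contDiff_wave
  abs_wave_le_one := abs_wave_le fun k => (abs_signs ω k).le
  abs_deriv_le := abs_deriv_wave_le hB hh fun k => (abs_signs ω k).le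

/-- The quadratic distance of two perturbed densities whose amplitudes differ on one bump. -/
theorem integral_sq_sub_le {W W' : ℝ → ℝ} (H : Admissible ε h B W)
    {c b : ℝ} (hc : |c| ≤ 2) (hWW : ∀ x, W x - W' x = c * cutoff (x / h - b)) :
    ∫ z, (perturbedDensity ε h W z.1 z.2 - perturbedDensity ε h W' z.1 z.2) ^ 2 ∂uniformSquare ≤
      16 * (ε * B) ^ 2 * h ^ 4 := by
  have hε := H.eps_pos
  have hh := H.h_pos
  have hB := H.bound_pos
  -- The box outside which the difference of the densities vanishes. Its area `4 * h ^ 2` times the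
  -- squared height `4 * (ε * B) ^ 2 * h ^ 2` is the claimed bound.
  set S : Set (ℝ × ℝ) := Set.Icc (1 / 2 - h) (1 / 2 + h) ×ˢ Set.Icc (b * h - h) (b * h + h) with hS
  have hSm : MeasurableSet S := measurableSet_Icc.prod measurableSet_Icc
  have hSv : volume.real S = 4 * h ^ 2 := by
    rw [hS, Measure.volume_eq_prod, measureReal_prod_prod, Real.volume_real_Icc_of_le (by linarith),
      Real.volume_real_Icc_of_le (by linarith)]
    ring
  have hSu : uniformSquare.real S ≤ 4 * h ^ 2 := by
    rw [← hSv]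
    refine ENNReal.toReal_mono ?_ (Measure.restrict_apply_le _ _)
    exact (isCompact_Icc.prod isCompact_Icc).measure_lt_top.ne
  have hpt : ∀ z : ℝ × ℝ,
      (perturbedDensity ε h W z.1 z.2 - perturbedDensity ε h W' z.1 z.2) ^ 2 ≤
        S.indicator (fun _ => 4 * (ε * B) ^ 2 * h ^ 2) z := by
    rintro ⟨y, x⟩
    have e : perturbedDensity ε h W y x - perturbedDensity ε h W' y x =
        ε * h * deriv ramp ((y - 1 / 2) / h) * (c * cutoff (x / h - b)) := by
      rw [← hWW, perturbedDensity, perturbedDensity]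
      ring
    dsimp only
    rw [e]
    by_cases hz : (y, x) ∈ S
    · rw [Set.indicator_of_mem hz]
      have : |ε * h * deriv ramp ((y - 1 / 2) / h) * (c * cutoff (x / h - b))| ≤
          ε * h * B * (2 * 1) := by
        rw [abs_mul, abs_mul, abs_of_pos (by positivity : 0 < ε * h), abs_mul]
        gcongr
        · exact H.isCutoffBound.deriv_ramp_le _
        · exact abs_cutoff_le_one _
      calc _ ≤ (ε * h * B * (2 * 1)) ^ 2 := sq_le_sq.2 (this.trans (le_abs_self _))
        _ = _ := by ring
    · rw [Set.indicator_of_notMem hz]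
      have : 1 ≤ |(y - 1 / 2) / h| ∨ 1 ≤ |x / h - b| := by
        by_contra! hlt
        refine hz ⟨?_, ?_⟩
        · have := hlt.1
          rw [abs_div, abs_of_pos hh, div_lt_one hh, abs_lt] at this
          exact ⟨by linarith, by linarith⟩
        · have h₁ : x - b * h = (x / h - b) * h := by field_simp
          have h₂ : |x - b * h| < h := by
            rw [h₁, abs_mul, abs_of_pos hh]
            exact mul_lt_of_lt_one_left hh hlt.2
          rw [abs_lt] at h₂
          exact ⟨by linarith, by linarith⟩
      rcases this with h₁ | h₁
      · rw [deriv_ramp_eq_zero h₁]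
        simp
      · rw [cutoff_eq_zero h₁]
        simp
  calc _ ≤ ∫ z, S.indicator (fun _ => 4 * (ε * B) ^ 2 * h ^ 2) z ∂uniformSquare := by
        refine integral_mono_of_nonneg (.of_forall fun z => sq_nonneg _) ?_ (.of_forall hpt)
        exact (integrable_const _).indicator hSm
    _ = uniformSquare.real S * (4 * (ε * B) ^ 2 * h ^ 2) := by
        rw [integral_indicator_const _ hSm, smul_eq_mul]
    _ ≤ 4 * h ^ 2 * (4 * (ε * B) ^ 2 * h ^ 2) := by gcongr
    _ = _ := by ring

/-- The loss of a data-based pricing function integrated over a set of covariate values. -/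
def lossOn {W : ℝ → ℝ} (H : Admissible ε h B W) {n : ℕ} (q : DataPricing n) (s : Set ℝ)
    (d : Fin n → ℝ × ℝ) : ℝ :=
  ∫ x in s, H.loss (q.price d x) x

section lossOn

variable {W : ℝ → ℝ} (H : Admissible ε h B W) {n : ℕ} (q : DataPricing n)
include H

theorem integrableOn_loss (d : Fin n → ℝ × ℝ) :
    IntegrableOn (fun x => H.loss (q.price d x) x) (Set.Ioc (0 : ℝ) 1) := by
  have hq : Measurable (q.price d) := q.measurable_price.comp measurable_prodMk_left
  refine Integrable.of_bound (H.measurable_loss hq measurable_id).aestronglyMeasurable 6 ?_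
  exact (ae_restrict_mem measurableSet_Ioc).mono fun x hx =>
    H.abs_loss_le (q.price_mem d x (Set.Ioc_subset_Icc_self hx)) x

theorem ae_loss_nonneg (d : Fin n → ℝ × ℝ) :
    0 ≤ᵐ[volume.restrict (Set.Ioc (0 : ℝ) 1)] fun x => H.loss (q.price d x) x :=
  (ae_restrict_mem measurableSet_Ioc).mono fun x hx =>
    H.loss_nonneg (q.price_mem d x (Set.Ioc_subset_Icc_self hx)) x

theorem lossOn_nonneg {s : Set ℝ} (hs : s ⊆ Set.Ioc (0 : ℝ) 1) (d : Fin n → ℝ × ℝ) :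
    0 ≤ H.lossOn q s d :=
  integral_nonneg_of_ae (ae_restrict_of_ae_restrict_of_subset hs (H.ae_loss_nonneg q d))

theorem integrable_mul_lossOn {s : Set ℝ} (hs : s ⊆ Set.Ioc (0 : ℝ) 1) :
    Integrable (fun d : Fin n → ℝ × ℝ =>
      (∏ i, perturbedDensity ε h W (d i).1 (d i).2) * H.lossOn q s d)
      (Measure.pi fun _ => uniformSquare) := by
  have hL : Integrable (fun d : Fin n → ℝ × ℝ => ∏ i, perturbedDensity ε h W (d i).1 (d i).2)
      (Measure.pi fun _ => uniformSquare) :=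
    .fintype_prod (f := fun _ (z : ℝ × ℝ) => perturbedDensity ε h W z.1 z.2)
      (fun _ => H.integrable_density)
  refine hL.mul_bdd (c := 6) ?_ (.of_forall fun d => ?_)
  · have : Measurable (fun z : (Fin n → ℝ × ℝ) × ℝ => H.loss (q.price z.1 z.2) z.2) :=
      H.measurable_loss q.measurable_price measurable_snd
    exact (this.stronglyMeasurable.integral_prod_right
      (ν := volume.restrict s)).aestronglyMeasurable
  · rw [Real.norm_eq_abs, abs_of_nonneg (H.lossOn_nonneg q hs d)]
    have h₁ : H.lossOn q s d ≤ H.lossOn q (Set.Ioc 0 1) d :=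
      setIntegral_mono_set (H.integrableOn_loss q d) (H.ae_loss_nonneg q d)
        (Filter.Eventually.of_forall hs)
    have h₂ := norm_setIntegral_le_of_norm_le_const (μ := volume) (s := Set.Ioc (0 : ℝ) 1)
      (f := fun x => H.loss (q.price d x) x) (C := 6) (by simp) fun x hx =>
        H.abs_loss_le (q.price_mem d x (Set.Ioc_subset_Icc_self hx)) x
    have h₃ : |H.lossOn q (Set.Ioc 0 1) d| ≤ 6 := by simpa [lossOn] using h₂
    exact h₁.trans ((le_abs_self _).trans h₃)

/-- The cells are disjoint subsets of the unit interval and the loss is nonnegative, so discarding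
the rest of the interval only lowers the integral. -/
theorem sum_integral_lossOn_le {m : ℕ} (hm : 2 * m * h = 1) :
    ∑ k : Fin m, ∫ d, (∏ i, perturbedDensity ε h W (d i).1 (d i).2) * H.lossOn q (cell h k) d
        ∂(Measure.pi fun _ : Fin n => uniformSquare) ≤
      H.jointDist.optimalRevenue - H.jointDist.meanRevenue q := by
  have hsub := cell_subset H.h_pos hm
  refine le_trans ?_ (H.integral_loss_le q)
  rw [← integral_finsetSum _ fun k _ => H.integrable_mul_lossOn q (hsub k)]
  refine integral_mono (integrable_finsetSum _ fun k _ => H.integrable_mul_lossOn q (hsub k))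
    (H.integrable_mul_lossOn q subset_rfl) fun d => ?_
  dsimp only
  rw [← Finset.mul_sum]
  refine mul_le_mul_of_nonneg_left ?_
    (Finset.prod_nonneg fun i _ => by linarith [H.density_ge (d i).1 (d i).2])
  have h₁ : ∑ k : Fin m, H.lossOn q (cell h k) d =
      ∫ x in ⋃ k : Fin m, cell h k, H.loss (q.price d x) x :=
    (integral_iUnion_fintype (fun k : Fin m => measurableSet_cell (k : ℕ))
      (fun i j hij => disjoint_cell H.h_pos fun e => hij (Fin.ext e))
      fun k => (H.integrableOn_loss q d).mono_set (hsub k)).symm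
  rw [h₁]
  exact setIntegral_mono_set (H.integrableOn_loss q d) (H.ae_loss_nonneg q d)
    (Filter.Eventually.of_forall (Set.iUnion_subset hsub))

end lossOn

/-- On each cell, the mean losses under two neighbouring vertices of the hypercube are not both
small. -/
theorem le_cell_loss {m n : ℕ} (hm : 2 * m * h = 1) (hn : n * h ^ 4 ≤ 1 / 16) {k : Fin m}
    {ω ω' : Fin m → Bool} (hk : signs ω' k = -signs ω k)
    (hne : ∀ j, j ≠ k → signs ω' j = signs ω j) (H : Admissible ε h B (wave h (signs ω)))
    (H' : Admissible ε h B (wave h (signs ω'))) (q : DataPricing n) :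
    ε ^ 2 * h ^ 3 / 64 ≤
      ∫ d, (∏ i, perturbedDensity ε h (wave h (signs ω)) (d i).1 (d i).2) *
        H.lossOn q (cell h k) d ∂(Measure.pi fun _ : Fin n => uniformSquare) +
      ∫ d, (∏ i, perturbedDensity ε h (wave h (signs ω')) (d i).1 (d i).2) *
        H'.lossOn q (cell h k) d ∂(Measure.pi fun _ : Fin n => uniformSquare) := by
  have hh := H.h_pos
  have hε := H.eps_pos
  have hsub := cell_subset hh hm k
  have hdist : n * ∫ z, (perturbedDensity ε h (wave h (signs ω)) z.1 z.2 -
      perturbedDensity ε h (wave h (signs ω')) z.1 z.2) ^ 2 ∂uniformSquare ≤ 1 := by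
    have h₁ := H.integral_sq_sub_le (W' := wave h (signs ω')) (c := signs ω k - signs ω' k) (by
      rw [hk, sub_neg_eq_add]
      exact (abs_add_le _ _).trans (by rw [abs_signs]; norm_num))
      fun x => wave_sub_wave (fun j hj => (hne j hj).symm) x
    have h₂ : ε * B ≤ 1 := by linarith [H.eps_mul_le, H.eps_le]
    have h₃ : 0 ≤ ε * B := mul_nonneg hε.le H.bound_pos.le
    calc _ ≤ n * (16 * (ε * B) ^ 2 * h ^ 4) := by gcongr
      _ = 16 * (n * h ^ 4) * (ε * B) ^ 2 := by ring
      _ ≤ 16 * (1 / 16) * 1 ^ 2 := by gcongr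
      _ = 1 := by norm_num
  have haff := half_le_affinity_pow H.continuous_density.measurable
    H'.continuous_density.measurable (fun z => H.density_ge _ _) (fun z => H'.density_ge _ _)
    (fun z => H.density_le _ _) (fun z => H'.density_le _ _) H.integral_density_uniformSquare
    H'.integral_density_uniformSquare hdist
  have hsqrt : Integrable (fun z : ℝ × ℝ => √(perturbedDensity ε h (wave h (signs ω)) z.1 z.2 *
      perturbedDensity ε h (wave h (signs ω')) z.1 z.2)) uniformSquare := by
    refine .of_bound (H.continuous_density.mul H'.continuous_density).sqrt.aestronglyMeasurable 2
      (.of_forall fun z => ?_)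
    rw [Real.norm_eq_abs, abs_of_nonneg (Real.sqrt_nonneg _)]
    refine Real.sqrt_le_iff.2 ⟨by norm_num, ?_⟩
    nlinarith [H.density_ge z.1 z.2, H'.density_ge z.1 z.2, H.density_le z.1 z.2,
      H'.density_le z.1 z.2]
  -- The pointwise bound `ε ^ 2 * h ^ 2 / 8` holds on the whole cell, whose length `h` supplies the
  -- third power.
  have hsum : ∀ d, ε ^ 2 * h ^ 3 / 8 ≤ H.lossOn q (cell h k) d + H'.lossOn q (cell h k) d := by
    intro d
    have I := (H.integrableOn_loss q d).mono_set hsub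
    have I' := (H'.integrableOn_loss q d).mono_set hsub
    rw [lossOn, lossOn, ← integral_add I I']
    have hle : ∫ _x in cell h k, ε ^ 2 * h ^ 2 / 8 ≤
        ∫ x in cell h k, (H.loss (q.price d x) x + H'.loss (q.price d x) x) := by
      refine setIntegral_mono_on (integrableOn_const (by simp [cell])) (I.add I')
        (measurableSet_cell _) fun x hx => ?_
      have hx' := abs_sub_le_of_mem_cell hh hx
      exact H.le_loss_add_loss H' (signs_sq ω k) (wave_eq_of_abs_le hx')
        ((wave_eq_of_abs_le hx').trans hk) _
    rw [setIntegral_const, volume_real_cell hh, smul_eq_mul] at hle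
    refine le_trans (le_of_eq ?_) hle
    ring
  have := le_two_point_loss H.integrable_density H'.integrable_density
    (fun z => by linarith [H.density_ge z.1 z.2]) (fun z => by linarith [H'.density_ge z.1 z.2])
    H.integral_density_uniformSquare H'.integral_density_uniformSquare hsqrt haff
    (by positivity) (H.lossOn_nonneg q hsub) (H'.lossOn_nonneg q hsub) hsum
    (H.integrable_mul_lossOn q hsub) (H'.integrable_mul_lossOn q hsub)
  refine le_trans (le_of_eq ?_) this
  ring

end Admissible

/-! ### Assembly: vertex, bandwidth and rate -/

/-- For every data-based pricing function some vertex of the hypercube of perturbations has a large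
deficiency. -/
theorem exists_signs_deficiency_ge {ε h B : ℝ} (hB : IsCutoffBound B) (hε : 0 < ε)
    (hεB : ε * B ^ 2 ≤ 1 / 4) (hh : 0 < h) (hh2 : h ≤ 1 / 2) {m n : ℕ} (hm : 2 * m * h = 1)
    (hn : n * h ^ 4 ≤ 1 / 16) (q : DataPricing n) :
    ∃ ω : Fin m → Bool, ε ^ 2 * h ^ 2 / 256 ≤
      (Admissible.of_signs hB hε hεB hh hh2 ω).jointDist.optimalRevenue -
        (Admissible.of_signs hB hε hεB hh hh2 ω).jointDist.meanRevenue q := by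
  have H : ∀ ω : Fin m → Bool, Admissible ε h B (wave h (signs ω)) :=
    Admissible.of_signs hB hε hεB hh hh2
  obtain ⟨ω, hω⟩ := exists_half_le_sum (τ := ε ^ 2 * h ^ 3 / 64) (T := fun (k : Fin m) ω =>
    ∫ d, (∏ i, perturbedDensity ε h (wave h (signs ω)) (d i).1 (d i).2) *
        (H ω).lossOn q (cell h k) d ∂(Measure.pi fun _ : Fin n => uniformSquare))
    fun k ω => Admissible.le_cell_loss hm hn (signs_flip_self k ω)
      (fun j hj => signs_flip_of_ne hj ω) (H ω) (H _) q
  refine ⟨ω, le_trans (le_of_eq ?_) (hω.trans ((H ω).sum_integral_lossOn_le q hm))⟩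
  -- The number of cells `m = 1 / (2 * h)` trades one power of `h` for the remaining factor: `m * (ε
  -- ^ 2 * h ^ 3 / 64) / 2`.
  calc ε ^ 2 * h ^ 2 / 256 = (2 * m * h) * (ε ^ 2 * h ^ 2 / 256) := by rw [hm, one_mul]
    _ = _ := by ring

/-- A bandwidth of order `n ^ (-1 / 4)` that divides the unit interval evenly. -/
theorem exists_bandwidth {n : ℕ} (hn : 1 ≤ n) : ∃ (m : ℕ) (h : ℝ), 0 < h ∧ h ≤ 1 / 2 ∧
    2 * m * h = 1 ∧ n * h ^ 4 ≤ 1 / 16 ∧ (n : ℝ) ^ (-(1 / 2) : ℝ) / 16 ≤ h ^ 2 := by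
  have hn1 : (1 : ℝ) ≤ n := by exact_mod_cast hn
  set r : ℝ := (n : ℝ) ^ (1 / 4 : ℝ) with hr
  have hr1 : 1 ≤ r := Real.one_le_rpow hn1 (by norm_num)
  have hr4 : r ^ 4 = n := by
    rw [hr, ← Real.rpow_natCast, ← Real.rpow_mul (by linarith)]
    norm_num
  have hr2 : (n : ℝ) ^ (-(1 / 2) : ℝ) = 1 / r ^ 2 := by
    rw [Real.rpow_neg (by linarith), hr, ← Real.rpow_natCast, ← Real.rpow_mul (by linarith)]
    norm_num
  have hm₁ : r ≤ ⌈r⌉₊ := Nat.le_ceil r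
  have hm₂ : (⌈r⌉₊ : ℝ) < r + 1 := Nat.ceil_lt_add_one (by linarith)
  set M : ℝ := ((⌈r⌉₊ : ℕ) : ℝ) with hM
  have hM1 : 1 ≤ M := hr1.trans hm₁
  have hMpos : 0 < M := by linarith
  have hrpos : 0 < r := by linarith
  -- With `r = n ^ (1 / 4)`, rounding up gives `n * h ^ 4 ≤ 1 / 16`, and `M ≤ r + 1 ≤ 2 * r` limits
  -- the loss from rounding.
  refine ⟨⌈r⌉₊, 1 / (2 * M), by positivity, ?_, ?_, ?_, ?_⟩
  · rw [div_le_div_iff₀ (by positivity) (by norm_num)]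
    linarith
  · rw [← hM]
    field_simp
  · rw [← hr4, div_pow, one_pow, mul_one_div, div_le_div_iff₀ (by positivity) (by norm_num)]
    have := pow_le_pow_left₀ hrpos.le hm₁ 4
    nlinarith
  · rw [hr2, div_pow, one_pow, div_div, div_le_div_iff₀ (by positivity) (by positivity)]
    have : M ^ 2 ≤ (2 * r) ^ 2 := pow_le_pow_left₀ hMpos.le (by linarith) 2
    nlinarith

end Pricing

end

theorem theorem2 (C₀ Cstar Cbar Cmarg cmarg : ℝ) (hC₀ : 0 < C₀)
    (hCstar : 0 < Cstar) (hCstar2 : Cstar < 2) (hCbar : 2 < Cbar)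
    (hcmarg : 0 < cmarg) (hcmarg1 : cmarg ≤ 1) (hCmarg : 1 ≤ Cmarg) :
    ∃ c : ℝ, 0 < c ∧ ∀ n : ℕ, 1 ≤ n →
      ((c * (n : ℝ) ^ (-(1 / 2) : ℝ) : ℝ) : EReal) ≤
        Pricing.minimaxDeficiency n (Pricing.distClass C₀ Cstar Cbar Cmarg cmarg) := by
  obtain ⟨B, hB⟩ := Pricing.exists_isCutoffBound
  have hB0 : 0 < B := zero_lt_one.trans_le hB.one_le
  -- Here `δ` plays the role of `ε * B ^ 2`. It is positive because the constants of the class leave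
  -- room on both sides of the uniform curvature `2`.
  obtain ⟨δ, hδ, hδ₀, hδ₁, hδ₂, hδ₃⟩ : ∃ δ : ℝ, 0 < δ ∧ δ ≤ C₀ ∧ 2 * δ ≤ 2 - Cstar ∧
      2 * δ ≤ Cbar - 2 ∧ δ ≤ 1 / 4 := by
    refine ⟨min (min C₀ ((2 - Cstar) / 2)) (min ((Cbar - 2) / 2) (1 / 4)), ?_, ?_, ?_, ?_, ?_⟩
    · refine lt_min (lt_min hC₀ ?_) (lt_min ?_ ?_) <;> linarith
    · exact (min_le_left _ _).trans (min_le_left _ _)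
    · linarith [(min_le_left (min C₀ ((2 - Cstar) / 2)) (min ((Cbar - 2) / 2) (1 / 4))).trans
        (min_le_right _ _)]
    · linarith [(min_le_right (min C₀ ((2 - Cstar) / 2)) (min ((Cbar - 2) / 2) (1 / 4))).trans
        (min_le_left _ _)]
    · exact (min_le_right _ _).trans (min_le_right _ _)
  have hε : 0 < δ / B ^ 2 := by positivity
  have hεB : δ / B ^ 2 * B ^ 2 = δ := div_mul_cancel₀ _ (by positivity)
  -- `4096 = 256 * 16`: the deficiency constant times the one from `exists_bandwidth`.
  refine ⟨(δ / B ^ 2) ^ 2 / 4096, by positivity, fun n hn => le_iInf fun q => ?_⟩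
  obtain ⟨m, h, hh, hh2, hm, hnh, hrate⟩ := Pricing.exists_bandwidth hn
  obtain ⟨ω, hω⟩ := Pricing.exists_signs_deficiency_ge hB hε (hεB.trans_le hδ₃) hh hh2 hm hnh q
  refine le_iSup₂_of_le _ ((Pricing.Admissible.of_signs hB hε (hεB.trans_le hδ₃) hh hh2 ω).regular
    (by rwa [hεB]) (by rwa [hεB]) (by rwa [hεB]) hcmarg1 hCmarg) (EReal.coe_le_coe_iff.2 ?_)
  refine le_trans ?_ hω
  nlinarith [mul_le_mul_of_nonneg_left hrate (sq_nonneg (δ / B ^ 2))]
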